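/- **Resolvent bound.** Let $n\ge 1$. An $n\times n$ *Wigner matrix* is a random Hermitian matrix $M_n=(\xi_{ij})_{1\le i,j\le n}$ such that the entries $\xi_{ij}$, $1\le i\le j\le n$, are jointly independent with mean zero, $\mathbb E|\xi_{ij}|^2=1$ for $i<j$, $\mathbb E\,\xi_{ii}^2=\sigma^2$ for all $i$ with some $\sigma>0$ not depending on $i$, and such that $\operatorname{Re}\xi_{ij}$ and $\operatorname{Im}\xi_{ij}$ are independent for each $i<j$. The entries need not be identically distributed. For constants $C,C'>0$ we say that $M_n$ obeys the exponential decay condition with constants $C,C'$ if $$\mathbb P(|\xi_{ij}|\ge t^{C})\le e^{-t}\qquad\text{for all }1\le i,j\le n\text{ and all }t\ge C'.$$ Put $W_n:=\frac1{\sqrt n}M_n$, $R(z):=(W_n-z)^{-1}$ for $\operatorname{Im} z>0$, and $\|R(z)\|_{(\infty,1)}:=\sup_{1\le i,j\le n}|R(z)_{ij}|$. For all $C,C'>0$ and all real $B,D$ there are constants $K,L,a,c>0$, depending only on $C,C',B,D$, such that for every $n\ge1$, every $\sigma>0$, every $n\times n$ Wigner matrix $M_n$ with diagonal variance $\sigma^2$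 that obeys the exponential decay condition with constants $C,C'$, and every $z=E+\sqrt{-1}\,\eta$ with $|E|\le B$ and $0<\eta\le D\,n^{100}$, $$\mathbb P\bigl(\|R(z)\|_{(\infty,1)}>K\bigr)\le L\,n^{a}\exp\bigl(-c\,(n\eta)^{c}\bigr).$$ -/

import Mathlib

open MeasureTheory ProbabilityTheory

/-- `M` is an `n × n` Wigner matrix on the probability space `(Ω, μ)`, with diagonal variance
`σ ^ 2`.  For a centred complex random variable the variance is `E |ξ|²`. -/
structure IsWigner {Ω : Type*} [MeasurableSpace Ω] (μ : Measure Ω) {n : ℕ} (σ : ℝ)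
    (M : Ω → Matrix (Fin n) (Fin n) ℂ) : Prop where
  measurable_entry : ∀ i j, Measurable fun ω => M ω i j
  isHermitian : ∀ ω, (M ω).IsHermitian
  /-- The entries on and above the diagonal are jointly independent. -/
  iIndepFun_upper :
    iIndepFun (fun (p : {p : Fin n × Fin n // p.1 ≤ p.2}) ω => M ω p.1.1 p.1.2) μ
  /-- The second moments are finite, so that means and variances make sense. -/
  memLp_two : ∀ i j, MemLp (fun ω => M ω i j) 2 μ
  mean_zero : ∀ i j, ∫ ω, M ω i j ∂μ = 0
  variance_offDiag : ∀ i j, i < j → ∫ ω, ‖M ω i j‖ ^ 2 ∂μ = 1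
  variance_diag : ∀ i, ∫ ω, ‖M ω i i‖ ^ 2 ∂μ = σ ^ 2
  indepFun_re_im : ∀ i j, i < j →
    IndepFun (fun ω => (M ω i j).re) (fun ω => (M ω i j).im) μ

/-- The exponential decay condition `P(|ξ_ij| ≥ t ^ C) ≤ exp (-t)` for all `i, j` and all
`t ≥ C'`, with explicit constants `C` and `C'`. -/
def ExpDecay {Ω : Type*} [MeasurableSpace Ω] (μ : Measure Ω) {n : ℕ} (C C' : ℝ)
    (M : Ω → Matrix (Fin n) (Fin n) ℂ) : Prop :=
  ∀ i j, ∀ t : ℝ, C' ≤ t → μ.real {ω | t ^ C ≤ ‖M ω i j‖} ≤ Real.exp (-t)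

/-- The normalised matrix `W = n ^ (-1/2) M`. -/
noncomputable def normalized {n : ℕ} (M : Matrix (Fin n) (Fin n) ℂ) :
    Matrix (Fin n) (Fin n) ℂ :=
  ((Real.sqrt n : ℂ)⁻¹) • M

/-- The resolvent `R(z) = (W - z)⁻¹`.  It is only used for Hermitian `W` and `z` off the real
line, where `W - z` is invertible. -/
noncomputable def resolventMatrix {n : ℕ} (W : Matrix (Fin n) (Fin n) ℂ) (z : ℂ) :
    Matrix (Fin n) (Fin n) ℂ :=
  (W - z • (1 : Matrix (Fin n) (Fin n) ℂ))⁻¹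

/-- The coefficient norm `‖A‖_(∞,1) = sup_{i,j} |A i j|`. -/
noncomputable def coeffNorm {n : ℕ} (A : Matrix (Fin n) (Fin n) ℂ) : ℝ :=
  ⨆ p : Fin n × Fin n, ‖A p.1 p.2‖

/-! Write `R'` for the resolvent of `W` with row and column `i` set to zero. Schur's formula reads
`R_ii (W_ii - z - Q_i) = 1`, where `Q_i` is a quadratic form in row `i` whose coefficients are
entries of `R'`, and the row is independent of `R'`. So `Q_i` concentrates around `1/n` times the
trace of `R'` over the indices other than `i`, which is within `1/(nη)` of `s = (tr R)/n`
(`norm_trace_minor_sub_le`). Hence `R_ii (z + s - ε_i) = -1` with `ε_i` small, and averaging over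
`i` gives `s (z + s) ≈ -1`. This relation alone bounds `s` and keeps `z + s` away from `0`
(`self_consistent_bounds`), so the diagonal entries are bounded without any comparison with the
semicircle law. An off-diagonal entry is `-R_ii` times a linear form in row `i`, which concentrates
too.

The fluctuations scale with the Frobenius norm of `R'`. By the Ward identity its square is `Im tr R'
/ η`, so an a priori bound on `R` is needed. It comes from a bootstrap over dyadic scales:
`norm_resolvent_half_le` passes from `2η` to `η` at the price of a factor `2`, and
`norm_resolvent_le_of_fluctuation` brings `2K` back to `K`. The start is `Im z ≥ 1`, where `|R_ij| ≤
1 / Im z` suffices. If `nη < 8K` the claimed probability bound exceeds `1`; otherwise at most `n +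
1` scales occur.

For the concentration, stretched exponential tails give moments of order `p` growing like a power of
`p`, to the `p`. `integral_norm_add_pow_le` carries this growth to linear and quadratic forms by
adding one variable at a time, and Markov's inequality at the best moment turns it back into a tail.
The diagonal of `M` is controlled by its tails only, so all constants are uniform in `σ`. -/

open scoped ComplexConjugate Matrix

namespace WignerResolvent

/-! ### Even moments of a sum of two orthogonal variables. -/

section

lemma tangent_le_pow (q : ℕ) {b x : ℝ} (hb : 0 ≤ b) (hx : 0 ≤ x) :
    b ^ (q + 1) + (q + 1) * b ^ q * (x - b) ≤ x ^ (q + 1) := by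
  induction q with
  | zero => simp
  | succ q ih =>
    have h1 := mul_le_mul_of_nonneg_left ih hx
    have h2 : 0 ≤ ((q : ℝ) + 1) * b ^ q * (x - b) ^ 2 := by positivity
    push_cast
    calc _ = x * (b ^ (q + 1) + (q + 1) * b ^ q * (x - b)) - ((q : ℝ) + 1) * b ^ q * (x - b) ^ 2 := by
          ring
      _ ≤ x * x ^ (q + 1) := by linarith
      _ = _ := by ring

/-- Taylor's formula to second order on `[0, w]`. Bounding `(x - a) ^ 2` by `w * c` supplies the
factor that turns the remainder's `w ^ (q - 1)` into `w ^ q`, so `q = 0` needs no separate form. -/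
lemma pow_le_tangent_add (q : ℕ) {a x w c : ℝ} (ha : 0 ≤ a) (hx : 0 ≤ x) (haw : a ≤ w)
    (hxw : x ≤ w) (hc : 0 ≤ c) (h : (x - a) ^ 2 ≤ w * c) :
    x ^ (q + 1) ≤ a ^ (q + 1) + (q + 1) * a ^ q * (x - a) + (q + 1) * q / 2 * c * w ^ q := by
  have hw : 0 ≤ w := ha.trans haw
  induction q with
  | zero => simp
  | succ q ih =>
    have h1 := mul_le_mul_of_nonneg_left ih hx
    have h2 : a ^ q * (x - a) ^ 2 ≤ w ^ q * (w * c) := by gcongr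
    have h3 : x * (((q : ℝ) + 1) * q / 2 * c * w ^ q) ≤ w * (((q : ℝ) + 1) * q / 2 * c * w ^ q) := by
      gcongr
    have h4 := mul_le_mul_of_nonneg_left h2 (by positivity : (0 : ℝ) ≤ q + 1)
    push_cast
    calc x ^ (q + 1 + 1) = x * x ^ (q + 1) := by ring
      _ ≤ _ := h1
      _ = a ^ (q + 2) + (q + 2) * a ^ (q + 1) * (x - a) + (q + 1) * (a ^ q * (x - a) ^ 2)
          + x * (((q : ℝ) + 1) * q / 2 * c * w ^ q) := by ring
      _ ≤ a ^ (q + 2) + (q + 2) * a ^ (q + 1) * (x - a) + (q + 1) * (w ^ q * (w * c))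
          + w * (((q : ℝ) + 1) * q / 2 * c * w ^ q) := by linarith
      _ = _ := by ring

/-- Second-order expansion of `N ^ (q + 1)` in `N = ‖S + y‖ ^ 2` around `‖S‖ ^ 2`, whose increment
is at most `2 ‖y‖ (‖S‖ + ‖y‖)`. The cross term is kept exact because it will integrate to zero. -/
lemma norm_add_pow_le (q : ℕ) (S y : ℂ) :
    ‖S + y‖ ^ (2 * (q + 1)) ≤ ‖S‖ ^ (2 * (q + 1))
      + 2 * (q + 1) * (‖S‖ ^ (2 * q) * (conj S * y).re)
      + 2 * (q + 1) ^ 2 * (‖y‖ ^ 2 * ((‖S‖ + ‖y‖) ^ 2) ^ q) := by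
  have hN : ‖S + y‖ ^ 2 = ‖S‖ ^ 2 + 2 * (conj S * y).re + ‖y‖ ^ 2 := by
    simp only [Complex.sq_norm, Complex.normSq_apply, Complex.add_re, Complex.add_im,
      Complex.mul_re, Complex.conj_re, Complex.conj_im]
    ring
  have hr : |(conj S * y).re| ≤ ‖S‖ * ‖y‖ := by
    refine (Complex.abs_re_le_norm _).trans ?_
    simp
  have hS := norm_nonneg S
  have hy := norm_nonneg y
  rw [abs_le] at hr
  have key := pow_le_tangent_add q (a := ‖S‖ ^ 2) (x := ‖S + y‖ ^ 2) (w := (‖S‖ + ‖y‖) ^ 2)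
    (c := 4 * ‖y‖ ^ 2) (by positivity) (by positivity) (by gcongr; linarith)
    (by gcongr; exact norm_add_le _ _) (by positivity) (by
      rw [hN]
      have : |‖S‖ ^ 2 + 2 * (conj S * y).re + ‖y‖ ^ 2 - ‖S‖ ^ 2| ≤ 2 * ‖y‖ * (‖S‖ + ‖y‖) := by
        rw [abs_le]; constructor <;> nlinarith
      calc _ = |‖S‖ ^ 2 + 2 * (conj S * y).re + ‖y‖ ^ 2 - ‖S‖ ^ 2| ^ 2 := (sq_abs _).symm
        _ ≤ (2 * ‖y‖ * (‖S‖ + ‖y‖)) ^ 2 := by gcongr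
        _ = _ := by ring)
  have h2 : (‖S‖ ^ 2) ^ q ≤ ((‖S‖ + ‖y‖) ^ 2) ^ q := by gcongr; linarith
  have h3 : ((q : ℝ) + 1) * ‖y‖ ^ 2 * (‖S‖ ^ 2) ^ q ≤
      ((q : ℝ) + 1) * ‖y‖ ^ 2 * ((‖S‖ + ‖y‖) ^ 2) ^ q := by gcongr
  have h4 : 0 ≤ ((q : ℝ) + 1) * ‖y‖ ^ 2 * ((‖S‖ + ‖y‖) ^ 2) ^ q := by positivity
  rw [pow_mul, pow_mul, pow_mul]
  rw [hN] at key ⊢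
  nlinarith

lemma mul_pow_le_pow_add (q : ℕ) {a b : ℝ} (ha : 0 ≤ a) (hb : 0 ≤ b) :
    a * b ^ q ≤ a ^ (q + 1) / (q + 1) + q * b ^ (q + 1) / (q + 1) := by
  have := tangent_le_pow q hb ha
  rw [← add_div, le_div_iff₀ (by positivity)]
  simp only [pow_succ] at this ⊢
  linarith

/-- A substitute for Hölder's inequality: once integrated against `E u ^ (q + 1) ≤ T ^ (q + 1)` and
`E w ^ (q + 1) ≤ b ^ (q + 1)`, the right side is the value of the left side at `(T, b)`. With `V = T
+ (q + 1) b`, `u + (q + 1) w` is `V` times a convex combination of `u / T` and `w / b`; Young's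
inequality and convexity of the power give the weights. -/
lemma exists_young_weights (q : ℕ) {T b : ℝ} (hT : 0 < T) (hb : 0 < b) :
    ∃ α β : ℝ, 0 ≤ α ∧ 0 ≤ β ∧ α + β = 1 ∧ ∀ u w : ℝ, 0 ≤ u → 0 ≤ w →
      w * (u + (q + 1) * w) ^ q ≤ b * (T + (q + 1) * b) ^ q *
        (α * (u ^ (q + 1) / T ^ (q + 1)) + β * (w ^ (q + 1) / b ^ (q + 1))) := by
  set V := T + (q + 1) * b with hV
  have hVpos : 0 < V := by positivity
  set l := T / V with hl
  have hl0 : 0 ≤ l := by positivity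
  have hl1 : (q + 1) * b / V = 1 - l := by
    rw [hl]; field_simp; rw [hV]; ring
  have hl2 : 0 ≤ 1 - l := by rw [← hl1]; positivity
  refine ⟨q / (q + 1) * l, 1 / (q + 1) + q / (q + 1) * (1 - l), by positivity, by positivity, ?_, ?_⟩
  · field_simp; ring
  intro u w hu hw
  have h1 : (u + (q + 1) * w) = V * (l * (u / T) + (1 - l) * (w / b)) := by
    rw [← hl1, hl]; field_simp
  have h2 := mul_pow_le_pow_add q (a := w / b) (b := l * (u / T) + (1 - l) * (w / b))
    (by positivity) (by positivity)
  have h3 : (l * (u / T) + (1 - l) * (w / b)) ^ (q + 1) ≤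
      l * (u / T) ^ (q + 1) + (1 - l) * (w / b) ^ (q + 1) := by
    have := (convexOn_pow (𝕜 := ℝ) (q + 1)).2 (x := u / T) (y := w / b)
      (by simp; positivity) (by simp; positivity) hl0 hl2 (by ring)
    simpa using this
  have h4 : w = b * (w / b) := by field_simp
  calc w * (u + (q + 1) * w) ^ q
      = b * V ^ q * (w / b * (l * (u / T) + (1 - l) * (w / b)) ^ q) := by
        rw [h1, mul_pow]; nth_rewrite 1 [h4]; ring
    _ ≤ b * V ^ q * ((w / b) ^ (q + 1) / (q + 1) +
        q * (l * (u / T) ^ (q + 1) + (1 - l) * (w / b) ^ (q + 1)) / (q + 1)) := by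
        gcongr
        refine h2.trans ?_
        gcongr
    _ = _ := by
        rw [div_pow, div_pow]
        field_simp
        ring

lemma one_add_inv_pow_le (q : ℕ) : (1 + 1 / ((q : ℝ) + 1)) ^ q ≤ 3 := by
  have h1 : 1 + 1 / ((q : ℝ) + 1) ≤ Real.exp (1 / ((q : ℝ) + 1)) := by
    linarith [Real.add_one_le_exp (1 / ((q : ℝ) + 1))]
  calc _ ≤ Real.exp (1 / ((q : ℝ) + 1)) ^ q := by gcongr
    _ = Real.exp (q * (1 / ((q : ℝ) + 1))) := (Real.exp_nat_mul _ _).symm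
    _ ≤ Real.exp 1 := by
      gcongr
      rw [mul_one_div, div_le_one (by positivity)]
      linarith
    _ ≤ 3 := by linarith [Real.exp_one_lt_d9]

/-- The weight `q + 1` on `y ^ 2` makes the loss only `1 + 1/(q + 1)`, whose `q`-th power stays
bounded. -/
lemma add_sq_pow_le (q : ℕ) (s y : ℝ) :
    ((s + y) ^ 2) ^ q ≤ 3 * (s ^ 2 + (q + 1) * y ^ 2) ^ q := by
  have h : (s + y) ^ 2 ≤ (1 + 1 / ((q : ℝ) + 1)) * (s ^ 2 + (q + 1) * y ^ 2) := by
    have hq : (0 : ℝ) < q + 1 := by positivity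
    have : 0 ≤ (s - (q + 1) * y) ^ 2 / (q + 1) := by positivity
    have e : (1 + 1 / ((q : ℝ) + 1)) * (s ^ 2 + (q + 1) * y ^ 2) - (s + y) ^ 2
        = (s - (q + 1) * y) ^ 2 / (q + 1) := by field_simp; ring
    linarith
  calc _ ≤ ((1 + 1 / ((q : ℝ) + 1)) * (s ^ 2 + (q + 1) * y ^ 2)) ^ q := by gcongr
    _ = (1 + 1 / ((q : ℝ) + 1)) ^ q * (s ^ 2 + (q + 1) * y ^ 2) ^ q := mul_pow _ _ _
    _ ≤ _ := by gcongr; exact one_add_inv_pow_le q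

variable {Ω : Type*} [MeasurableSpace Ω] {μ : Measure Ω}

/-- Even moments of a sum of two "orthogonal" variables: the square of the `L^(2p)` norm is
additive up to a factor linear in `p`. -/
lemma integral_norm_add_pow_le [IsFiniteMeasure μ] (q : ℕ) {S y : Ω → ℂ} {T b : ℝ}
    (hT : 0 < T) (hb : 0 < b)
    (hS : MemLp S (2 * (q + 1) : ℕ) μ) (hy : MemLp y (2 * (q + 1) : ℕ) μ)
    (hST : ∫ ω, ‖S ω‖ ^ (2 * (q + 1)) ∂μ ≤ T ^ (q + 1))
    (hyb : ∫ ω, ‖y ω‖ ^ (2 * (q + 1)) ∂μ ≤ b ^ (q + 1))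
    (horth : ∫ ω, ‖S ω‖ ^ (2 * q) * (conj (S ω) * y ω).re ∂μ = 0) :
    ∫ ω, ‖S ω + y ω‖ ^ (2 * (q + 1)) ∂μ ≤ (T + 7 * (q + 1) * b) ^ (q + 1) := by
  obtain ⟨α, β, hα, hβ, hαβ, hyoung⟩ := exists_young_weights q hT hb
  have iS := hS.integrable_norm_pow (by simp)
  have iy := hy.integrable_norm_pow (by simp)
  have iSy := (hS.add hy).integrable_norm_pow (by simp)
  simp only [Pi.add_apply] at iSy
  set V := T + (q + 1) * b with hV
  have hVpos : 0 < V := by positivity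
  have iX : Integrable (fun ω => ‖S ω‖ ^ (2 * q) * (conj (S ω) * y ω).re) μ := by
    refine (iS.add iy).mono' ?_ (Filter.Eventually.of_forall fun ω => ?_)
    · have h1 := hS.1
      have h2 := hy.1
      have h3 : AEStronglyMeasurable (fun ω => conj (S ω) * y ω) μ :=
        (Complex.continuous_conj.comp_aestronglyMeasurable h1).mul h2
      exact (h1.norm.pow _).mul (Complex.continuous_re.comp_aestronglyMeasurable h3)
    · have h := Complex.abs_re_le_norm (conj (S ω) * y ω)
      rw [norm_mul, Complex.norm_conj] at h
      rw [norm_mul, norm_pow, norm_norm, Real.norm_eq_abs, Pi.add_apply]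
      have hs := norm_nonneg (S ω)
      have hy' := norm_nonneg (y ω)
      calc ‖S ω‖ ^ (2 * q) * |(conj (S ω) * y ω).re| ≤ ‖S ω‖ ^ (2 * q) * (‖S ω‖ * ‖y ω‖) := by gcongr
        _ ≤ max ‖S ω‖ ‖y ω‖ ^ (2 * q) * (max ‖S ω‖ ‖y ω‖ * max ‖S ω‖ ‖y ω‖) := by
          gcongr <;> simp
        _ = max ‖S ω‖ ‖y ω‖ ^ (2 * (q + 1)) := by ring
        _ ≤ _ := by
          rcases max_cases ‖S ω‖ ‖y ω‖ with h | h <;> rw [h.1] <;>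
            simp only [le_add_iff_nonneg_left, le_add_iff_nonneg_right] <;> positivity
  have hpt : ∀ ω, ‖S ω + y ω‖ ^ (2 * (q + 1)) ≤ ‖S ω‖ ^ (2 * (q + 1))
      + 2 * (q + 1) * (‖S ω‖ ^ (2 * q) * (conj (S ω) * y ω).re)
      + 6 * (q + 1) ^ 2 * (b * V ^ q) * (α / T ^ (q + 1) * ‖S ω‖ ^ (2 * (q + 1))
        + β / b ^ (q + 1) * ‖y ω‖ ^ (2 * (q + 1))) := by
    intro ω
    refine (norm_add_pow_le q _ _).trans ?_
    have h1 := hyoung (‖S ω‖ ^ 2) (‖y ω‖ ^ 2) (by positivity) (by positivity)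
    have h2 := add_sq_pow_le q ‖S ω‖ ‖y ω‖
    refine add_le_add le_rfl ?_
    calc 2 * ((q : ℝ) + 1) ^ 2 * (‖y ω‖ ^ 2 * ((‖S ω‖ + ‖y ω‖) ^ 2) ^ q)
        ≤ 2 * ((q : ℝ) + 1) ^ 2 * (‖y ω‖ ^ 2 * (3 * (‖S ω‖ ^ 2 + (q + 1) * ‖y ω‖ ^ 2) ^ q)) := by gcongr
      _ = 6 * ((q : ℝ) + 1) ^ 2 * (‖y ω‖ ^ 2 * (‖S ω‖ ^ 2 + (q + 1) * ‖y ω‖ ^ 2) ^ q) := by ring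
      _ ≤ 6 * ((q : ℝ) + 1) ^ 2 * _ := mul_le_mul_of_nonneg_left h1 (by positivity)
      _ = _ := by rw [pow_mul, pow_mul]; ring
  have hint := integral_mono iSy (((iS.add (iX.const_mul (2 * ((q : ℝ) + 1)))).add
    (((iS.const_mul (α / T ^ (q + 1))).add (iy.const_mul (β / b ^ (q + 1)))).const_mul
      (6 * ((q : ℝ) + 1) ^ 2 * (b * V ^ q))))) hpt
  rw [integral_add' (iS.add (iX.const_mul _)) (((iS.const_mul _).add (iy.const_mul _)).const_mul _),
    integral_add' iS (iX.const_mul _), integral_const_mul, horth, integral_const_mul] at hint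
  simp only [Pi.add_apply] at hint
  rw [integral_add (iS.const_mul _) (iy.const_mul _), integral_const_mul, integral_const_mul] at hint
  have h1 : α / T ^ (q + 1) * ∫ ω, ‖S ω‖ ^ (2 * (q + 1)) ∂μ ≤ α := by
    calc _ ≤ α / T ^ (q + 1) * T ^ (q + 1) := by gcongr
      _ = α := by field_simp
  have h2 : β / b ^ (q + 1) * ∫ ω, ‖y ω‖ ^ (2 * (q + 1)) ∂μ ≤ β := by
    calc _ ≤ β / b ^ (q + 1) * b ^ (q + 1) := by gcongr
      _ = β := by field_simp
  -- The integrated bound is at most `V ^ (q + 1) + (q + 1) V ^ q * 6 (q + 1) b`, the tangent at `V`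
  -- evaluated at `V + 6 (q + 1) b`. The constant `7` is this `6` plus the `1` inside `V`.
  have h3 := tangent_le_pow q hVpos.le (x := T + 7 * (q + 1) * b) (by positivity)
  have h4 : T ^ (q + 1) ≤ V ^ (q + 1) := by
    gcongr; rw [hV]; linarith [show 0 ≤ ((q : ℝ) + 1) * b by positivity]
  have h5 : 6 * ((q : ℝ) + 1) ^ 2 * (b * V ^ q) * (α / T ^ (q + 1) * ∫ ω, ‖S ω‖ ^ (2 * (q + 1)) ∂μ
      + β / b ^ (q + 1) * ∫ ω, ‖y ω‖ ^ (2 * (q + 1)) ∂μ) ≤ 6 * ((q : ℝ) + 1) ^ 2 * (b * V ^ q) * 1 := by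
    gcongr; linarith
  have h6 : T + 7 * (q + 1) * b - V = 6 * (q + 1) * b := by rw [hV]; ring
  rw [h6] at h3
  linarith [show (q + 1) * V ^ q * (6 * (q + 1) * b) = 6 * ((q : ℝ) + 1) ^ 2 * (b * V ^ q) * 1 by ring]

end

/-! ### Moments of linear and quadratic forms in independent centred variables. -/

section

variable {Ω : Type*} [MeasurableSpace Ω] {μ : Measure Ω}

/-- All absolute moments of `f` are finite. -/
def HasMoments (f : Ω → ℂ) (μ : Measure Ω) : Prop := ∀ p : ℕ, MemLp f p μ

namespace HasMoments

variable {f g : Ω → ℂ}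

lemma mul (hf : HasMoments f μ) (hg : HasMoments g μ) : HasMoments (fun ω => f ω * g ω) μ := by
  intro p
  have h1 := hf (2 * p)
  have h2 := hg (2 * p)
  have : ENNReal.HolderTriple ((2 * p : ℕ) : ENNReal) ((2 * p : ℕ) : ENNReal) (p : ENNReal) := ⟨by
    push_cast
    rw [ENNReal.mul_inv (by simp) (by simp), ← add_mul, ENNReal.inv_two_add_inv_two, one_mul]⟩
  exact MemLp.mul' h2 h1

lemma add (hf : HasMoments f μ) (hg : HasMoments g μ) : HasMoments (fun ω => f ω + g ω) μ :=
  fun p => (hf p).add (hg p)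

lemma const [IsFiniteMeasure μ] (c : ℂ) : HasMoments (fun _ : Ω => c) μ := fun _ => memLp_const c

lemma conj' (hf : HasMoments f μ) : HasMoments (fun ω => conj (f ω)) μ := fun p => (hf p).star

lemma pow [IsFiniteMeasure μ] (hf : HasMoments f μ) (q : ℕ) : HasMoments (fun ω => f ω ^ q) μ := by
  induction q with
  | zero => simpa using const 1
  | succ q ih => simpa [pow_succ] using ih.mul hf

lemma sum {ι : Type*} (s : Finset ι) {f : ι → Ω → ℂ} (hf : ∀ i ∈ s, HasMoments (f i) μ) :
    HasMoments (fun ω => ∑ i ∈ s, f i ω) μ :=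
  fun p => memLp_finsetSum s fun i hi => hf i hi p

lemma integrable (hf : HasMoments f μ) : Integrable f μ := by
  have := hf 1
  rw [Nat.cast_one] at this
  exact memLp_one_iff_integrable.1 this

lemma integrable_norm_pow [IsFiniteMeasure μ] (hf : HasMoments f μ) (p : ℕ) :
    Integrable (fun ω => ‖f ω‖ ^ p) μ := (hf p).integrable_norm_pow'

end HasMoments

section Independent

variable {ι : Type*} [DecidableEq ι] {x : ι → Ω → ℂ}

lemma indepFun_comp_of_notMem (hind : iIndepFun x μ) (hm : ∀ i, Measurable (x i)) {s : Finset ι}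
    {j : ι} (hj : j ∉ s) {γ : Type*} [MeasurableSpace γ] {φ : (s → ℂ) → γ} (hφ : Measurable φ) :
    IndepFun (fun ω => φ fun i : s => x i ω) (x j) μ := by
  have h := hind.indepFun_finset s {j} (by simpa using hj) hm
  have hψ : Measurable fun y : ({j} : Finset ι) → ℂ => y ⟨j, Finset.mem_singleton_self j⟩ :=
    measurable_pi_apply _
  exact h.comp hφ hψ

lemma integral_re_mul_eq_zero {f y : Ω → ℂ} (hfy : IndepFun f y μ) (hf : HasMoments f μ)
    (hy : HasMoments y μ) (h0 : ∫ ω, y ω ∂μ = 0) : ∫ ω, (f ω * y ω).re ∂μ = 0 := by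
  have h := hfy.integral_fun_mul_eq_mul_integral hf.integrable.1 hy.integrable.1
  have h2 := integral_re (𝕜 := ℂ) (hf.mul hy).integrable
  simp only [RCLike.re_eq_complex_re] at h2
  rw [h2, h, h0, mul_zero, Complex.zero_re]

lemma norm_pow_mul_re (q : ℕ) (S y : ℂ) :
    ‖S‖ ^ (2 * q) * (conj S * y).re = (conj S ^ (q + 1) * S ^ q * y).re := by
  have : conj S ^ (q + 1) * S ^ q * y = ((‖S‖ ^ (2 * q) : ℝ) : ℂ) * (conj S * y) := by
    rw [pow_mul, ← Complex.normSq_eq_norm_sq]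
    push_cast
    rw [Complex.normSq_eq_conj_mul_self]
    ring
  rw [this, Complex.re_ofReal_mul]

variable [IsProbabilityMeasure μ]

/-- Each new term is centred and independent of the partial sum, so the cross term vanishes and the
squared norms add up to a factor `7 (q + 1)`. The initial `m * F` and the padding `F / card ι` keep
both variances positive; they cost one extra `m * F` each, whence `1 + 7 * 2 = 15`. -/
lemma integral_norm_linear_pow_le [Fintype ι] (hind : iIndepFun x μ) (hm : ∀ i, Measurable (x i))
    (hmom : ∀ i, HasMoments (x i) μ) (h0 : ∀ i, ∫ ω, x i ω ∂μ = 0) (q : ℕ) {m : ℝ} (hmpos : 0 < m)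
    (hxm : ∀ i, ∫ ω, ‖x i ω‖ ^ (2 * (q + 1)) ∂μ ≤ m ^ (q + 1))
    (a : ι → ℂ) {F : ℝ} (hF : 0 < F) (s : Finset ι) (haF : ∑ i ∈ s, ‖a i‖ ^ 2 ≤ F) :
    ∫ ω, ‖∑ i ∈ s, a i * x i ω‖ ^ (2 * (q + 1)) ∂μ ≤ (15 * (q + 1) * m * F) ^ (q + 1) := by
  have key : ∀ s : Finset ι, ∫ ω, ‖∑ i ∈ s, a i * x i ω‖ ^ (2 * (q + 1)) ∂μ ≤
      (m * F + 7 * (q + 1) * ∑ i ∈ s, m * (‖a i‖ ^ 2 + F / Fintype.card ι)) ^ (q + 1) := by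
    intro s
    induction s using Finset.induction with
    | empty => simp; positivity
    | insert j s hj ih =>
      have hcard : (0 : ℝ) < Fintype.card ι := by
        exact_mod_cast Fintype.card_pos_iff.2 ⟨j⟩
      have hS : HasMoments (fun ω => ∑ i ∈ s, a i * x i ω) μ :=
        HasMoments.sum s fun i _ => (HasMoments.const _).mul (hmom i)
      have hy : HasMoments (fun ω => a j * x j ω) μ := (HasMoments.const _).mul (hmom j)
      have := integral_norm_add_pow_le q (S := fun ω => ∑ i ∈ s, a i * x i ω)
        (y := fun ω => a j * x j ω) (b := m * (‖a j‖ ^ 2 + F / Fintype.card ι)) (by positivity)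
        (by positivity) (hS _) (hy _) ih ?_ ?_
      · simp only [Finset.sum_insert hj]
        simp only [add_comm (a j * x j _)]
        refine this.trans (le_of_eq ?_)
        ring
      · simp only [norm_mul, mul_pow]
        rw [integral_const_mul, pow_mul]
        calc (‖a j‖ ^ 2) ^ (q + 1) * ∫ ω, ‖x j ω‖ ^ (2 * (q + 1)) ∂μ
            ≤ (‖a j‖ ^ 2 + F / Fintype.card ι) ^ (q + 1) * m ^ (q + 1) := by
              gcongr
              · linarith [show 0 ≤ F / Fintype.card ι by positivity]
              · exact hxm j
          _ = _ := by rw [← mul_pow, mul_comm, mul_pow]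
      · simp only [norm_pow_mul_re]
        have hind' := indepFun_comp_of_notMem hind hm hj (φ := fun y : s → ℂ =>
          conj (∑ i : s, a i * y i) ^ (q + 1) * (∑ i : s, a i * y i) ^ q * a j)
          (by fun_prop)
        have e : ∀ ω, ∑ i : s, a i * x i ω = ∑ i ∈ s, a i * x i ω := fun ω =>
          Finset.sum_coe_sort s fun i => a i * x i ω
        simp only [e] at hind'
        have := integral_re_mul_eq_zero hind'
          (((hS.conj'.pow (q + 1)).mul (hS.pow q)).mul (HasMoments.const _)) (hmom j) (h0 j)
        simpa only [mul_assoc] using this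
  refine (key s).trans ?_
  have h1 : ∑ i ∈ s, m * (‖a i‖ ^ 2 + F / Fintype.card ι) ≤ m * (2 * F) := by
    rw [← Finset.mul_sum, Finset.sum_add_distrib]
    gcongr
    have : ∑ _i ∈ s, F / Fintype.card ι ≤ F := by
      rw [Finset.sum_const, nsmul_eq_mul]
      rcases Nat.eq_zero_or_pos (Fintype.card ι) with h | h
      · simp [h, hF.le]
      · have h' : (0 : ℝ) < Fintype.card ι := by exact_mod_cast h
        have h3 : (s.card : ℝ) ≤ Fintype.card ι := by exact_mod_cast Finset.card_le_univ s
        rw [mul_div_assoc', div_le_iff₀ h']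
        nlinarith
    linarith
  have h2 : m * F + 7 * (q + 1) * (m * (2 * F)) ≤ 15 * (q + 1) * m * F := by
    nlinarith [mul_pos hmpos hF, show (0 : ℝ) ≤ q * (m * F) by positivity]
  have h3 : 0 ≤ ∑ i ∈ s, m * (‖a i‖ ^ 2 + F / Fintype.card ι) :=
    Finset.sum_nonneg fun i _ => by positivity
  refine pow_le_pow_left₀ (by positivity) (le_trans ?_ h2) _
  gcongr

lemma integral_norm_linear_conj_pow_le [Fintype ι] (hind : iIndepFun x μ)
    (hm : ∀ i, Measurable (x i))
    (hmom : ∀ i, HasMoments (x i) μ) (h0 : ∀ i, ∫ ω, x i ω ∂μ = 0) (q : ℕ) {m : ℝ} (hmpos : 0 < m)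
    (hxm : ∀ i, ∫ ω, ‖x i ω‖ ^ (2 * (q + 1)) ∂μ ≤ m ^ (q + 1))
    (a : ι → ℂ) {F : ℝ} (hF : 0 < F) (s : Finset ι) (haF : ∑ i ∈ s, ‖a i‖ ^ 2 ≤ F) :
    ∫ ω, ‖∑ i ∈ s, a i * conj (x i ω)‖ ^ (2 * (q + 1)) ∂μ ≤ (15 * (q + 1) * m * F) ^ (q + 1) := by
  have h := integral_norm_linear_pow_le hind hm hmom h0 q hmpos hxm (fun i => conj (a i)) hF s
    (by simpa using haF)
  convert h using 4 with ω
  rw [← Complex.norm_conj]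
  simp

/-- Moments of an off-diagonal quadratic form. -/
lemma integral_norm_quadratic_pow_le [Fintype ι] (hind : iIndepFun x μ) (hm : ∀ i, Measurable (x i))
    (hmom : ∀ i, HasMoments (x i) μ) (h0 : ∀ i, ∫ ω, x i ω ∂μ = 0) (q : ℕ) {m : ℝ} (hmpos : 0 < m)
    (hxm : ∀ i, ∫ ω, ‖x i ω‖ ^ (2 * (q + 1)) ∂μ ≤ m ^ (q + 1))
    (A : ι → ι → ℂ) (hA : ∀ i, A i i = 0) {F : ℝ} (hF : 0 < F)
    (hAF : ∑ i, ∑ j, ‖A i j‖ ^ 2 ≤ F) :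
    ∫ ω, ‖∑ i, ∑ j, A i j * x i ω * conj (x j ω)‖ ^ (2 * (q + 1)) ∂μ
      ≤ (1300 * (q + 1) ^ 2 * m ^ 2 * F) ^ (q + 1) := by
  -- Mass of row and column `k`, padded to be positive. The three contributions sum to at most `3 *
  -- F`.
  set r : ι → ℝ := fun k => ∑ j, ‖A k j‖ ^ 2 + ∑ i, ‖A i k‖ ^ 2 + F / Fintype.card ι with hr
  have key : ∀ s : Finset ι,
      ∫ ω, ‖∑ i ∈ s, ∑ j ∈ s, A i j * x i ω * conj (x j ω)‖ ^ (2 * (q + 1)) ∂μ ≤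
      (m ^ 2 * F + 7 * (q + 1) * ∑ k ∈ s, 4 * m * (15 * (q + 1) * m * r k)) ^ (q + 1) := by
    intro s
    induction s using Finset.induction with
    | empty => simp; positivity
    | insert k s hk ih =>
      have hcard : (0 : ℝ) < Fintype.card ι := by
        exact_mod_cast Fintype.card_pos_iff.2 ⟨k⟩
      have hrpos : ∀ k, 0 < r k := fun k => by
        have : 0 ≤ ∑ j, ‖A k j‖ ^ 2 + ∑ i, ‖A i k‖ ^ 2 := by positivity
        have : 0 < F / Fintype.card ι := by positivity
        simp only [hr]; linarith
      set S : Ω → ℂ := fun ω => ∑ i ∈ s, ∑ j ∈ s, A i j * x i ω * conj (x j ω) with hSdef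
      set u : Ω → ℂ := fun ω => ∑ j ∈ s, A k j * conj (x j ω) with hudef
      set v : Ω → ℂ := fun ω => ∑ i ∈ s, A i k * x i ω with hvdef
      have hS : HasMoments S μ := HasMoments.sum s fun i _ => HasMoments.sum s fun j _ =>
        ((HasMoments.const _).mul (hmom i)).mul (hmom j).conj'
      have hu : HasMoments u μ := HasMoments.sum s fun i _ => (HasMoments.const _).mul (hmom i).conj'
      have hv : HasMoments v μ := HasMoments.sum s fun i _ => (HasMoments.const _).mul (hmom i)
      have hxk := hmom k
      have hy : HasMoments (fun ω => u ω * x k ω + v ω * conj (x k ω)) μ :=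
        (hu.mul hxk).add (hv.mul hxk.conj')
      have eS : ∀ ω, ∑ i : s, ∑ j : s, A i j * x i ω * conj (x j ω) = S ω := fun ω => by
        rw [hSdef]
        simp only [← Finset.sum_coe_sort s]
      have eu : ∀ ω, ∑ j : s, A k j * conj (x j ω) = u ω := fun ω =>
        Finset.sum_coe_sort s fun i => A k i * conj (x i ω)
      have ev : ∀ ω, ∑ i : s, A i k * x i ω = v ω := fun ω =>
        Finset.sum_coe_sort s fun i => A i k * x i ω
      have hrow : ∑ j ∈ s, ‖A k j‖ ^ 2 ≤ r k := by
        have h1 : ∑ j ∈ s, ‖A k j‖ ^ 2 ≤ ∑ j, ‖A k j‖ ^ 2 :=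
          Finset.sum_le_univ_sum_of_nonneg fun _ => by positivity
        have h2 : 0 ≤ ∑ i, ‖A i k‖ ^ 2 := by positivity
        have : 0 < F / Fintype.card ι := by positivity
        simp only [hr]; linarith
      have hcol : ∑ i ∈ s, ‖A i k‖ ^ 2 ≤ r k := by
        have h1 : ∑ i ∈ s, ‖A i k‖ ^ 2 ≤ ∑ i, ‖A i k‖ ^ 2 :=
          Finset.sum_le_univ_sum_of_nonneg fun _ => by positivity
        have h2 : 0 ≤ ∑ j, ‖A k j‖ ^ 2 := by positivity
        have : 0 < F / Fintype.card ι := by positivity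
        simp only [hr]; linarith
      have hub := integral_norm_linear_conj_pow_le hind hm hmom h0 q hmpos hxm (A k) (hrpos k) s hrow
      have hvb := integral_norm_linear_pow_le hind hm hmom h0 q hmpos hxm (fun i => A i k)
        (hrpos k) s hcol
      -- Adjoining `k` adds `u x_k + v conj x_k`, where `u` and `v` are linear forms in the earlier
      -- variables and there is no `x_k conj x_k` term. The `4` in `b` comes from `2 ^ (2 (q + 1) -
      -- 1)` in the power mean inequality, doubled for the two forms.
      have := integral_norm_add_pow_le q (S := S)
        (y := fun ω => u ω * x k ω + v ω * conj (x k ω)) (b := 4 * m * (15 * (q + 1) * m * r k))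
        ?_ ?_ (hS _) (hy _) ih ?_ ?_
      · refine le_trans (le_of_eq ?_) (this.trans (le_of_eq ?_))
        · refine integral_congr_ae (Filter.Eventually.of_forall fun ω => ?_)
          simp only [Finset.sum_insert hk, hA, Finset.sum_add_distrib, hSdef, hudef, hvdef,
            Finset.sum_mul]
          congr 2
          have : ∀ i, A k i * x k ω * conj (x i ω) = A k i * conj (x i ω) * x k ω := fun i => by ring
          simp only [this]
          ring
        · rw [Finset.sum_insert hk]; ring
      · have : 0 ≤ ∑ k ∈ s, 4 * m * (15 * (q + 1) * m * r k) :=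
          Finset.sum_nonneg fun k _ => by have := hrpos k; positivity
        positivity
      · have := hrpos k; positivity
      · have hpt : ∀ ω, ‖u ω * x k ω + v ω * conj (x k ω)‖ ^ (2 * (q + 1)) ≤
            2 ^ (2 * (q + 1) - 1) * ((‖u ω‖ ^ (2 * (q + 1)) + ‖v ω‖ ^ (2 * (q + 1)))
              * ‖x k ω‖ ^ (2 * (q + 1))) := by
          intro ω
          calc _ ≤ ((‖u ω‖ + ‖v ω‖) * ‖x k ω‖) ^ (2 * (q + 1)) := by
                gcongr
                refine (norm_add_le _ _).trans (le_of_eq ?_)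
                simp; ring
            _ = (‖u ω‖ + ‖v ω‖) ^ (2 * (q + 1)) * ‖x k ω‖ ^ (2 * (q + 1)) := mul_pow _ _ _
            _ ≤ (2 ^ (2 * (q + 1) - 1) * (‖u ω‖ ^ (2 * (q + 1)) + ‖v ω‖ ^ (2 * (q + 1)))) *
                ‖x k ω‖ ^ (2 * (q + 1)) := by
                gcongr
                exact add_pow_le (norm_nonneg _) (norm_nonneg _) _
            _ = _ := by ring
        have hind' := (indepFun_comp_of_notMem hind hm hk (φ := fun y : s → ℂ =>
          ‖∑ j : s, A k j * conj (y j)‖ ^ (2 * (q + 1)) + ‖∑ i : s, A i k * y i‖ ^ (2 * (q + 1)))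
          (by fun_prop)).comp (φ := id) (ψ := fun z => ‖z‖ ^ (2 * (q + 1))) measurable_id
          (by fun_prop)
        simp only [Function.comp_def, id, eu, ev] at hind'
        have iuv := (hu.integrable_norm_pow (2 * (q + 1))).add (hv.integrable_norm_pow (2 * (q + 1)))
        have ix := hxk.integrable_norm_pow (2 * (q + 1))
        have iprod := hind'.integrable_mul iuv ix
        refine (integral_mono (hy.integrable_norm_pow _) (iprod.const_mul _) hpt).trans ?_
        rw [integral_const_mul]
        have e := hind'.integral_mul_eq_mul_integral iuv.1 ix.1
        simp only [Pi.mul_apply] at e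
        simp only [Pi.mul_apply]
        rw [e, integral_add (hu.integrable_norm_pow _) (hv.integrable_norm_pow _)]
        have hnx : 0 ≤ ∫ ω, ‖x k ω‖ ^ (2 * (q + 1)) ∂μ := integral_nonneg fun _ => by positivity
        have hRp := hrpos k
        calc _ ≤ 2 ^ (2 * (q + 1) - 1) * (((15 * (q + 1) * m * r k) ^ (q + 1)
              + (15 * (q + 1) * m * r k) ^ (q + 1)) * m ^ (q + 1)) := by
              gcongr
              exact hxm k
          _ = 2 ^ (2 * (q + 1) - 1 + 1) * ((15 * (q + 1) * m * r k) ^ (q + 1) * m ^ (q + 1)) := by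
              ring
          _ = (2 ^ 2) ^ (q + 1) * ((15 * (q + 1) * m * r k) ^ (q + 1) * m ^ (q + 1)) := by
              rw [← pow_mul]; congr 2
          _ = _ := by rw [← mul_pow, ← mul_pow]; ring
      · simp only [norm_pow_mul_re]
        have hi1 := indepFun_comp_of_notMem hind hm hk (φ := fun y : s → ℂ =>
          conj (∑ i : s, ∑ j : s, A i j * y i * conj (y j)) ^ (q + 1) *
            (∑ i : s, ∑ j : s, A i j * y i * conj (y j)) ^ q * (∑ j : s, A k j * conj (y j)))
          (by fun_prop)
        have hi2 := (indepFun_comp_of_notMem hind hm hk (φ := fun y : s → ℂ =>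
          conj (∑ i : s, ∑ j : s, A i j * y i * conj (y j)) ^ (q + 1) *
            (∑ i : s, ∑ j : s, A i j * y i * conj (y j)) ^ q * (∑ i : s, A i k * y i))
          (by fun_prop)).comp (φ := id) (ψ := fun z => conj z) measurable_id (by fun_prop)
        simp only [Function.comp_def, id, eu, ev, eS] at hi1 hi2
        have m0 := (hS.conj'.pow (q + 1)).mul (hS.pow q)
        have z1 := integral_re_mul_eq_zero hi1 (m0.mul hu) hxk (h0 k)
        have z2 := integral_re_mul_eq_zero hi2 (m0.mul hv) hxk.conj' (by
          rw [integral_conj, h0, map_zero])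
        simp only [mul_add, Complex.add_re]
        rw [integral_add]
        · simp only [mul_assoc] at z1 z2 ⊢
          rw [z1, z2, add_zero]
        · have := ((m0.mul hu).mul hxk).integrable.re
          simpa only [mul_assoc, RCLike.re_eq_complex_re] using this
        · have := ((m0.mul hv).mul hxk.conj').integrable.re
          simpa only [mul_assoc, RCLike.re_eq_complex_re] using this
  refine (key Finset.univ).trans ?_
  have h1 : ∑ k, 4 * m * (15 * (q + 1) * m * r k) ≤ 4 * m * (15 * (q + 1) * m * (3 * F)) := by
    rw [← Finset.mul_sum, ← Finset.mul_sum]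
    gcongr
    simp only [hr, Finset.sum_add_distrib]
    rw [Finset.sum_comm (f := fun k i => ‖A i k‖ ^ 2)]
    have : ∑ _i : ι, F / Fintype.card ι ≤ F := by
      rw [Finset.sum_const, nsmul_eq_mul, Finset.card_univ]
      rcases Nat.eq_zero_or_pos (Fintype.card ι) with h | h
      · simp [h, hF.le]
      · have h' : (0 : ℝ) < Fintype.card ι := by exact_mod_cast h
        rw [mul_div_cancel₀ _ h'.ne']
    linarith
  -- `1 + 7 * 4 * 15 * 3 = 1261`.
  have h2 : m ^ 2 * F + 7 * (q + 1) * (4 * m * (15 * (q + 1) * m * (3 * F)))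
      ≤ 1300 * (q + 1) ^ 2 * m ^ 2 * F := by
    have : 0 < m ^ 2 * F := by positivity
    have : (1 : ℝ) ≤ (q + 1) ^ 2 := by
      have : (0 : ℝ) ≤ q := by positivity
      nlinarith
    nlinarith
  have hr0 : ∀ k, 0 ≤ r k := fun k => by simp only [hr]; positivity
  have h3 : 0 ≤ ∑ k, 4 * m * (15 * (q + 1) * m * r k) :=
    Finset.sum_nonneg fun k _ => by have := hr0 k; positivity
  refine pow_le_pow_left₀ (by positivity) (le_trans ?_ h2) _
  gcongr

end Independent

end

/-! ### Passing between tails and moments; conditioning on an independent variable. -/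

section

variable {Ω : Type*} [MeasurableSpace Ω] {μ : Measure Ω}

/-- Stretched exponential tails of a random variable, with a natural exponent. -/
def HasTail (f : Ω → ℂ) (μ : Measure Ω) (k : ℕ) (c : ℝ) : Prop :=
  ∀ t : ℝ, c ≤ t → μ.real {ω | t ^ k ≤ ‖f ω‖} ≤ Real.exp (-t)

section Tail

variable [IsProbabilityMeasure μ] {f : Ω → ℂ} {k : ℕ} {c : ℝ}

/-- Layer-cake formula for `‖f‖ ^ (1/k)`, whose tail is at most `exp c * exp (-t)` for every `t >
0`, trivially so when `t < c`. The remaining integral is `Γ(k p)`. -/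
lemma HasTail.lintegral_le (hf : Measurable f) (hk : 1 ≤ k) (hc : 0 ≤ c) (h : HasTail f μ k c)
    {p : ℕ} (hp : 1 ≤ p) :
    ∫⁻ ω, ENNReal.ofReal (‖f ω‖ ^ p) ∂μ ≤ ENNReal.ofReal (Real.exp c * (k * p).factorial) := by
  have hkp : (0 : ℝ) < (k * p : ℕ) := by exact_mod_cast Nat.mul_pos hk hp
  have hk0 : (k : ℝ) ≠ 0 := by exact_mod_cast (by omega : k ≠ 0)
  have e1 : ∀ ω, ‖f ω‖ ^ p = (‖f ω‖ ^ (1 / (k : ℝ))) ^ ((k * p : ℕ) : ℝ) := fun ω => by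
    rw [← Real.rpow_mul (norm_nonneg _), ← Real.rpow_natCast]
    congr 1
    push_cast
    field_simp
  simp only [e1]
  rw [lintegral_rpow_eq_lintegral_meas_le_mul μ (Filter.Eventually.of_forall fun ω => by
    simp only [Pi.zero_apply]; positivity) (by fun_prop) hkp]
  have hb : ∀ t ∈ Set.Ioi (0 : ℝ), μ {ω | t ≤ ‖f ω‖ ^ (1 / (k : ℝ))} *
      ENNReal.ofReal (t ^ (((k * p : ℕ) : ℝ) - 1)) ≤
      ENNReal.ofReal (Real.exp c) * ENNReal.ofReal (Real.exp (-t) * t ^ (((k * p : ℕ) : ℝ) - 1)) := by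
    intro t ht
    have ht0 : 0 < t := ht
    rw [ENNReal.ofReal_mul (Real.exp_pos _).le, ← mul_assoc, ← ENNReal.ofReal_mul (Real.exp_pos _).le]
    gcongr
    rcases le_or_gt c t with hct | hct
    · have hsub : {ω | t ≤ ‖f ω‖ ^ (1 / (k : ℝ))} ⊆ {ω | t ^ k ≤ ‖f ω‖} := by
        intro ω hω
        simp only [Set.mem_ofPred_eq] at hω ⊢
        calc t ^ k ≤ (‖f ω‖ ^ (1 / (k : ℝ))) ^ k := by gcongr
          _ = ‖f ω‖ := by
            rw [← Real.rpow_natCast, ← Real.rpow_mul (norm_nonneg _)]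
            field_simp
            simp
      refine (measure_mono hsub).trans ?_
      rw [← ofReal_measureReal]
      apply ENNReal.ofReal_le_ofReal
      refine (h t hct).trans ?_
      rw [← Real.exp_add]
      apply Real.exp_le_exp.2
      linarith
    · refine prob_le_one.trans ?_
      rw [← ENNReal.ofReal_one]
      apply ENNReal.ofReal_le_ofReal
      rw [← Real.exp_add]
      apply Real.one_le_exp
      linarith
  have hG := Real.GammaIntegral_convergent hkp
  calc _ ≤ ENNReal.ofReal ((k * p : ℕ) : ℝ) * ∫⁻ t in Set.Ioi (0 : ℝ), ENNReal.ofReal (Real.exp c) *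
        ENNReal.ofReal (Real.exp (-t) * t ^ (((k * p : ℕ) : ℝ) - 1)) := by
        refine mul_le_mul' le_rfl ?_
        exact setLIntegral_mono' measurableSet_Ioi hb
    _ = ENNReal.ofReal ((k * p : ℕ) : ℝ) * (ENNReal.ofReal (Real.exp c) *
        ENNReal.ofReal (Real.Gamma ((k * p : ℕ) : ℝ))) := by
        rw [lintegral_const_mul' _ _ (by simp), Real.Gamma_eq_integral hkp,
          ofReal_integral_eq_lintegral_ofReal hG]
        refine (ae_restrict_iff' measurableSet_Ioi).2 (Filter.Eventually.of_forall fun t ht => ?_)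
        have ht0 : 0 < t := ht
        simp only [Pi.zero_apply]
        positivity
    _ = _ := by
        rw [← ENNReal.ofReal_mul (Real.exp_pos _).le, ← ENNReal.ofReal_mul hkp.le]
        congr 1
        rw [← Real.Gamma_nat_eq_factorial, Real.Gamma_add_one hkp.ne']
        ring

lemma HasTail.hasMoments (hf : Measurable f) (hk : 1 ≤ k) (hc : 0 ≤ c) (h : HasTail f μ k c) :
    HasMoments f μ := by
  have key : ∀ p : ℕ, 1 ≤ p → MemLp f p μ := by
    intro p hp
    have hp0 : p ≠ 0 := by omega
    rw [← integrable_norm_rpow_iff hf.aestronglyMeasurable (by simpa using hp0) (by simp)]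
    refine ⟨(hf.norm.pow_const _).aestronglyMeasurable, ?_⟩
    rw [hasFiniteIntegral_iff_ofReal (Filter.Eventually.of_forall fun ω => by
      simp only [Pi.zero_apply]; positivity)]
    refine lt_of_le_of_lt ?_ (ENNReal.ofReal_lt_top (r := Real.exp c * (k * p).factorial))
    simpa using h.lintegral_le hf hk hc hp
  intro p
  rcases Nat.eq_zero_or_pos p with rfl | hp
  · exact (key 1 le_rfl).mono_exponent (by simp)
  · exact key p hp

lemma HasTail.integral_le (hf : Measurable f) (hk : 1 ≤ k) (hc : 0 ≤ c) (h : HasTail f μ k c)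
    {p : ℕ} (hp : 1 ≤ p) :
    ∫ ω, ‖f ω‖ ^ p ∂μ ≤ Real.exp c * ((k * p : ℕ) : ℝ) ^ (k * p) := by
  have h1 := h.lintegral_le hf hk hc hp
  rw [← ofReal_integral_eq_lintegral_ofReal ((h.hasMoments hf hk hc).integrable_norm_pow p)
    (Filter.Eventually.of_forall fun ω => by simp only [Pi.zero_apply]; positivity),
    ENNReal.ofReal_le_ofReal_iff (by positivity)] at h1
  refine h1.trans ?_
  gcongr
  exact_mod_cast Nat.factorial_le_pow _

/-- Even moments, in the form used by the concentration bounds. -/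
lemma HasTail.integral_even_le (hf : Measurable f) (hk : 1 ≤ k) (hc : 0 ≤ c) (h : HasTail f μ k c)
    (q : ℕ) : ∫ ω, ‖f ω‖ ^ (2 * (q + 1)) ∂μ ≤
      (Real.exp c * (2 * k * (q + 1)) ^ (2 * k)) ^ (q + 1) := by
  refine (h.integral_le hf hk hc (by omega)).trans ?_
  rw [mul_pow, ← pow_mul]
  gcongr
  · exact le_self_pow₀ (Real.one_le_exp hc) (by omega)
  · refine le_of_eq ?_
    push_cast
    congr 1 <;> ring

/-- Serves the diagonal part of a quadratic form, which is a linear form in the centred variables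
`‖x i‖ ^ 2 - v i`. -/
lemma HasTail.integral_sq_sub_le (hf : Measurable f) (hk : 1 ≤ k) (hc : 0 ≤ c)
    (h : HasTail f μ k c) (q : ℕ) {v : ℝ} (hv0 : 0 ≤ v) (hv1 : v ≤ 1) :
    ∫ ω, ‖((‖f ω‖ ^ 2 - v : ℝ) : ℂ)‖ ^ (2 * (q + 1)) ∂μ ≤
      (8 * Real.exp c * (4 * k * (q + 1)) ^ (4 * k)) ^ (q + 1) := by
  have hpt : ∀ ω, ‖((‖f ω‖ ^ 2 - v : ℝ) : ℂ)‖ ^ (2 * (q + 1)) ≤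
      2 ^ (2 * (q + 1) - 1) * (‖f ω‖ ^ (4 * (q + 1)) + 1) := by
    intro ω
    rw [Complex.norm_real, Real.norm_eq_abs]
    calc |‖f ω‖ ^ 2 - v| ^ (2 * (q + 1)) ≤ (‖f ω‖ ^ 2 + 1) ^ (2 * (q + 1)) := by
          gcongr
          rw [abs_le]
          constructor <;> nlinarith [norm_nonneg (f ω)]
      _ ≤ 2 ^ (2 * (q + 1) - 1) * ((‖f ω‖ ^ 2) ^ (2 * (q + 1)) + 1 ^ (2 * (q + 1))) :=
          add_pow_le (by positivity) (by positivity) _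
      _ = _ := by rw [one_pow, ← pow_mul, show 2 * (2 * (q + 1)) = 4 * (q + 1) by ring]
  have i4 := (h.hasMoments hf hk hc).integrable_norm_pow (4 * (q + 1))
  refine (integral_mono_of_nonneg (Filter.Eventually.of_forall fun ω => by
    simp only [Pi.zero_apply]; positivity) ((i4.add (integrable_const 1)).const_mul _)
    (Filter.Eventually.of_forall hpt)).trans ?_
  rw [integral_const_mul]
  simp only [Pi.add_apply]
  rw [integral_add i4 (integrable_const 1)]
  have h4 := h.integral_le hf hk hc (p := 4 * (q + 1)) (by omega)
  simp only [integral_const, probReal_univ, smul_eq_mul, mul_one]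
  have hX1 : 1 ≤ Real.exp c * ((k * (4 * (q + 1)) : ℕ) : ℝ) ^ (k * (4 * (q + 1))) := by
    refine one_le_mul_of_one_le_of_one_le (Real.one_le_exp hc) (one_le_pow₀ ?_)
    exact_mod_cast Nat.mul_pos hk (by omega)
  calc _ ≤ (2 : ℝ) ^ (2 * (q + 1) - 1) *
        (Real.exp c * ((k * (4 * (q + 1)) : ℕ) : ℝ) ^ (k * (4 * (q + 1)))
          + Real.exp c * ((k * (4 * (q + 1)) : ℕ) : ℝ) ^ (k * (4 * (q + 1)))) := by
        gcongr
    _ = 2 ^ (2 * (q + 1) - 1 + 1) *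
        (Real.exp c * ((k * (4 * (q + 1)) : ℕ) : ℝ) ^ (k * (4 * (q + 1)))) := by ring
    _ = 4 ^ (q + 1) * (Real.exp c * (4 * k * (q + 1)) ^ (4 * k * (q + 1))) := by
        rw [show 2 * (q + 1) - 1 + 1 = 2 * (q + 1) by omega, pow_mul]
        rw [show k * (4 * (q + 1)) = 4 * k * (q + 1) by ring]
        push_cast
        norm_num
    _ ≤ 8 ^ (q + 1) * (Real.exp c ^ (q + 1) * (4 * k * (q + 1)) ^ (4 * k * (q + 1))) := by
        gcongr
        · norm_num
        · exact le_self_pow₀ (Real.one_le_exp hc) (by omega)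
    _ = _ := by rw [mul_pow (8 * Real.exp c), mul_pow 8, ← pow_mul]; ring

end Tail

/-- From moment growth to a stretched exponential tail, by Markov's inequality. -/
lemma measureReal_norm_gt_le [IsProbabilityMeasure μ] {Z : Ω → ℂ} (hZ : HasMoments Z μ)
    {G F : ℝ} (hG : 0 < G) (hF : 0 < F) {g : ℕ} (hg : 1 ≤ g)
    (hmom : ∀ q : ℕ, ∫ ω, ‖Z ω‖ ^ (2 * (q + 1)) ∂μ ≤ (G * (q + 1) ^ g * F) ^ (q + 1))
    {t : ℝ} (ht : 0 ≤ t) :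
    μ.real {ω | t * Real.sqrt F < ‖Z ω‖} ≤
      Real.exp (1 - (t ^ 2 / (Real.exp 1 * G)) ^ (1 / (g : ℝ))) := by
  set τ := (t ^ 2 / (Real.exp 1 * G)) ^ (1 / (g : ℝ)) with hτ
  have hτ0 : 0 ≤ τ := by positivity
  rcases lt_or_ge τ 1 with h1 | h1
  · exact measureReal_le_one.trans (Real.one_le_exp (by linarith))
  -- The moment of order `2 ⌊τ⌋` is the largest for which the moment bound still gains a factor `exp
  -- (-1)` per power; the result is `exp (-⌊τ⌋) ≤ exp (1 - τ)`. For `τ < 1` the claim is trivial.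
  obtain ⟨q, hq⟩ : ∃ q : ℕ, ⌊τ⌋₊ = q + 1 := Nat.exists_eq_succ_of_ne_zero
    (Nat.floor_pos.2 h1).ne'
  have hq1 : (q : ℝ) + 1 ≤ τ := by
    have := Nat.floor_le hτ0
    rw [hq] at this
    exact_mod_cast this
  have hq2 : τ < (q : ℝ) + 1 + 1 := by
    have := Nat.lt_floor_add_one τ
    rw [hq] at this
    exact_mod_cast this
  have hτg : τ ^ g = t ^ 2 / (Real.exp 1 * G) := by
    rw [hτ, ← Real.rpow_natCast, ← Real.rpow_mul (by positivity)]
    have : (g : ℝ) ≠ 0 := by exact_mod_cast (by omega : g ≠ 0)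
    rw [one_div, inv_mul_cancel₀ this, Real.rpow_one]
  have hqg : G * (q + 1) ^ g * F ≤ Real.exp (-1) * (t ^ 2 * F) := by
    have : ((q : ℝ) + 1) ^ g ≤ t ^ 2 / (Real.exp 1 * G) := by rw [← hτg]; gcongr
    calc _ ≤ G * (t ^ 2 / (Real.exp 1 * G)) * F := by gcongr
      _ = _ := by rw [Real.exp_neg]; field_simp
  have htpos : 0 < t ^ 2 := by
    rcases ht.eq_or_lt with h | h
    · exfalso
      rw [← h] at hqg
      have : 0 < G * ((q : ℝ) + 1) ^ g * F := by positivity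
      simp at hqg
      linarith
    · positivity
  have hM := mul_meas_ge_le_integral_of_nonneg (μ := μ) (f := fun ω => ‖Z ω‖ ^ (2 * (q + 1)))
    (Filter.Eventually.of_forall fun ω => by simp only [Pi.zero_apply]; positivity)
    (hZ.integrable_norm_pow _) ((t ^ 2 * F) ^ (q + 1))
  have hsub : {ω | t * Real.sqrt F < ‖Z ω‖} ⊆
      {ω | (t ^ 2 * F) ^ (q + 1) ≤ ‖Z ω‖ ^ (2 * (q + 1))} := by
    intro ω hω
    simp only [Set.mem_ofPred_eq] at hω ⊢
    rw [pow_mul]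
    gcongr
    calc t ^ 2 * F = (t * Real.sqrt F) ^ 2 := by rw [mul_pow, Real.sq_sqrt hF.le]
      _ ≤ _ := by gcongr
  refine (measureReal_mono hsub).trans ?_
  have h2 : (t ^ 2 * F) ^ (q + 1) * μ.real {ω | (t ^ 2 * F) ^ (q + 1) ≤ ‖Z ω‖ ^ (2 * (q + 1))} ≤
      (t ^ 2 * F) ^ (q + 1) * Real.exp (-1) ^ (q + 1) := by
    refine hM.trans ((hmom q).trans ?_)
    rw [← mul_pow]
    refine pow_le_pow_left₀ (by positivity) (hqg.trans (le_of_eq (by ring))) _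
  refine (le_of_mul_le_mul_left h2 (by positivity)).trans ?_
  rw [← Real.exp_nat_mul]
  apply Real.exp_le_exp.2
  push_cast
  linarith

/-- Integrating out an independent variable. -/
lemma measureReal_pair_mem_le [IsProbabilityMeasure μ] {α β : Type*} [MeasurableSpace α]
    [MeasurableSpace β] {X : Ω → α} {Y : Ω → β} (hXY : IndepFun X Y μ) (hX : Measurable X)
    (hY : Measurable Y) {S : Set (α × β)} (hS : MeasurableSet S) {ε : ℝ}
    (h : ∀ y, μ.real {ω | (X ω, y) ∈ S} ≤ ε) : μ.real {ω | (X ω, Y ω) ∈ S} ≤ ε := by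
  have hε : 0 ≤ ε := by
    obtain ⟨ω⟩ := nonempty_of_isProbabilityMeasure μ
    exact measureReal_nonneg.trans (h (Y ω))
  have e : μ {ω | (X ω, Y ω) ∈ S} = (μ.map fun ω => (X ω, Y ω)) S := by
    rw [Measure.map_apply (hX.prodMk hY) hS]
    rfl
  have : IsProbabilityMeasure (μ.map Y) := Measure.isProbabilityMeasure_map hY.aemeasurable
  refine ENNReal.toReal_le_of_le_ofReal hε ?_
  rw [e, hXY.map_prod_eq_prod_map_map hX.aemeasurable hY.aemeasurable, Measure.prod_apply_symm hS]
  calc _ ≤ ∫⁻ _, ENNReal.ofReal ε ∂(μ.map Y) := by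
        gcongr with y
        rw [Measure.map_apply hX (measurable_prodMk_right hS), ← ofReal_measureReal]
        exact ENNReal.ofReal_le_ofReal (h y)
    _ = _ := by simp

end

/-! ### Concentration of linear and quadratic forms. -/

section

variable {Ω : Type*} [MeasurableSpace Ω] {μ : Measure Ω}

/-- The constant in the moment bounds for linear and quadratic forms. -/
noncomputable def momentConst (k : ℕ) (c : ℝ) : ℝ := 1300 * Real.exp c ^ 2 * (4 * k) ^ (4 * k)

/-- The deviation probability at level `t`. -/
noncomputable def deviation (k : ℕ) (c t : ℝ) : ℝ :=
  Real.exp (1 - ((t / 2) ^ 2 / (Real.exp 1 * momentConst k c)) ^ (1 / ((4 * k + 2 : ℕ) : ℝ)))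

lemma momentConst_pos {k : ℕ} (hk : 1 ≤ k) (c : ℝ) : 0 < momentConst k c := by
  unfold momentConst
  have : (0 : ℝ) < k := by exact_mod_cast hk
  positivity

section Concentration

variable {ι : Type*} [DecidableEq ι] [Fintype ι] [IsProbabilityMeasure μ] {x : ι → Ω → ℂ} {k : ℕ}
  {c : ℝ}

lemma linear_moment_aux {k : ℕ} (hk : 1 ≤ k) {c : ℝ} (hc : 0 ≤ c) (q : ℕ) {F : ℝ} (hF : 0 < F) :
    15 * (q + 1) * (Real.exp c * (2 * k * (q + 1)) ^ (2 * k)) * F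
      ≤ momentConst k c * (q + 1) ^ (4 * k + 2) * F := by
  unfold momentConst
  have h1 : (1 : ℝ) ≤ q + 1 := by have : (0 : ℝ) ≤ q := q.cast_nonneg; linarith
  have h2 : (1 : ℝ) ≤ 4 * k := by have : (1 : ℝ) ≤ k := by exact_mod_cast hk
                                  linarith
  have h3 := Real.one_le_exp hc
  calc 15 * (q + 1) * (Real.exp c * (2 * k * (q + 1)) ^ (2 * k)) * F
      ≤ 1300 * (q + 1) * (Real.exp c * (4 * k * (q + 1)) ^ (2 * k)) * F := by
        gcongr <;> norm_num
    _ = 1300 * Real.exp c * (4 * k) ^ (2 * k) * (q + 1) ^ (2 * k + 1) * F := by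
        rw [mul_pow (4 * (k : ℝ))]; ring
    _ ≤ _ := by
        gcongr
        · exact le_self_pow₀ h3 (by norm_num)
        · norm_num
        · norm_num
        · norm_num

/-- This case dictates `momentConst` and the exponent `4 * k + 2`: two powers of `q + 1` from the
form and `4 * k` from the squared moment of the entries. -/
lemma quadratic_moment_aux {k : ℕ} (hk : 1 ≤ k) {c : ℝ} (q : ℕ) {F : ℝ} (hF : 0 < F) :
    1300 * (q + 1) ^ 2 * (Real.exp c * (2 * k * (q + 1)) ^ (2 * k)) ^ 2 * F
      ≤ momentConst k c * (q + 1) ^ (4 * k + 2) * F := by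
  unfold momentConst
  have h1 : (1 : ℝ) ≤ q + 1 := by have : (0 : ℝ) ≤ q := q.cast_nonneg; linarith
  calc 1300 * (q + 1) ^ 2 * (Real.exp c * (2 * k * (q + 1)) ^ (2 * k)) ^ 2 * F
      ≤ 1300 * (q + 1) ^ 2 * (Real.exp c * (4 * k * (q + 1)) ^ (2 * k)) ^ 2 * F := by
        gcongr; norm_num
    _ = _ := by
        rw [mul_pow, mul_pow (4 * (k : ℝ)), mul_pow _ _ 2, ← pow_mul, ← pow_mul]; ring

lemma diagonal_moment_aux {k : ℕ} (hk : 1 ≤ k) {c : ℝ} (hc : 0 ≤ c) (q : ℕ) {F : ℝ} (hF : 0 < F) :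
    15 * (q + 1) * (8 * Real.exp c * (4 * k * (q + 1)) ^ (4 * k)) * F
      ≤ momentConst k c * (q + 1) ^ (4 * k + 2) * F := by
  unfold momentConst
  have h1 : (1 : ℝ) ≤ q + 1 := by have : (0 : ℝ) ≤ q := q.cast_nonneg; linarith
  have h3 := Real.one_le_exp hc
  calc 15 * (q + 1) * (8 * Real.exp c * (4 * k * (q + 1)) ^ (4 * k)) * F
      = 120 * Real.exp c * (4 * k) ^ (4 * k) * (q + 1) ^ (4 * k + 1) * F := by
        rw [mul_pow (4 * (k : ℝ))]; ring
    _ ≤ _ := by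
        gcongr
        · norm_num
        · exact le_self_pow₀ h3 (by norm_num)
        · norm_num

/-- The halving in `deviation` is for quadratic forms, where `t` is shared between the diagonal and
off-diagonal parts. Linear forms have room to spare. -/
lemma exp_sub_rpow_le_deviation (hk : 1 ≤ k) (t : ℝ) :
    Real.exp (1 - (t ^ 2 / (Real.exp 1 * momentConst k c)) ^ (1 / ((4 * k + 2 : ℕ) : ℝ)))
      ≤ deviation k c t := by
  have := momentConst_pos hk c
  have ht : (t / 2) ^ 2 ≤ t ^ 2 := by nlinarith [sq_nonneg t]
  unfold deviation
  gcongr Real.exp (1 - (?_ / _) ^ _)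

/-- Concentration of linear forms. -/
lemma linear_concentration (hind : iIndepFun x μ) (hm : ∀ i, Measurable (x i))
    (h0 : ∀ i, ∫ ω, x i ω ∂μ = 0) (hk : 1 ≤ k) (hc : 0 ≤ c) (htail : ∀ i, HasTail (x i) μ k c)
    (a : ι → ℂ) {t : ℝ} (ht : 0 ≤ t) :
    μ.real {ω | t * Real.sqrt (∑ i, ‖a i‖ ^ 2) < ‖∑ i, a i * x i ω‖} ≤ deviation k c t := by
  have hmom : ∀ i, HasMoments (x i) μ := fun i => (htail i).hasMoments (hm i) hk hc
  have hk' : (0 : ℝ) < k := by exact_mod_cast hk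
  rcases (Finset.sum_nonneg fun i (_ : i ∈ Finset.univ) => sq_nonneg ‖a i‖).eq_or_lt with h | h
  · have ha : ∀ i, a i = 0 := fun i => by
      have := (Finset.sum_eq_zero_iff_of_nonneg fun i _ => sq_nonneg ‖a i‖).1 h.symm i
        (Finset.mem_univ i)
      simpa using this
    simp [ha]
    exact (Real.exp_pos _).le
  · refine (measureReal_norm_gt_le (HasMoments.sum _ fun i _ => (HasMoments.const _).mul (hmom i))
      (momentConst_pos hk c) h (g := 4 * k + 2) (by omega) (fun q => ?_) ht).trans
      (exp_sub_rpow_le_deviation hk t)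
    refine (integral_norm_linear_pow_le hind hm hmom h0 q (by positivity)
      (fun i => (htail i).integral_even_le (hm i) hk hc q) a h Finset.univ le_rfl).trans ?_
    exact pow_le_pow_left₀ (by positivity) (linear_moment_aux hk hc q h) _

/-- Concentration of quadratic forms around their mean. -/
lemma quadratic_concentration (hind : iIndepFun x μ) (hm : ∀ i, Measurable (x i))
    (h0 : ∀ i, ∫ ω, x i ω ∂μ = 0) (hk : 1 ≤ k) (hc : 0 ≤ c) (htail : ∀ i, HasTail (x i) μ k c)
    {v : ι → ℝ} (hv : ∀ i, ∫ ω, ‖x i ω‖ ^ 2 ∂μ = v i) (hv1 : ∀ i, v i ≤ 1)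
    (A : ι → ι → ℂ) {t : ℝ} (ht : 0 ≤ t) :
    μ.real {ω | t * Real.sqrt (∑ i, ∑ j, ‖A i j‖ ^ 2) <
      ‖∑ i, ∑ j, A i j * x i ω * conj (x j ω) - ∑ i, A i i * v i‖} ≤ 2 * deviation k c t := by
  have hmom : ∀ i, HasMoments (x i) μ := fun i => (htail i).hasMoments (hm i) hk hc
  have hk' : (0 : ℝ) < k := by exact_mod_cast hk
  set F := ∑ i, ∑ j, ‖A i j‖ ^ 2 with hF
  have hF0 : 0 ≤ F := by positivity
  rcases hF0.eq_or_lt with h | h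
  · have hA : ∀ i j, A i j = 0 := fun i j => by
      have h1 := (Finset.sum_eq_zero_iff_of_nonneg fun i _ => by positivity).1 h.symm i
        (Finset.mem_univ i)
      have h2 := (Finset.sum_eq_zero_iff_of_nonneg fun j _ => by positivity).1 h1 j
        (Finset.mem_univ j)
      simpa using h2
    simp [hA, ← h]
    exact (Real.exp_pos _).le
  -- Off-diagonal part `B` plus a linear form in the independent centred variables `ξ i`, each
  -- allowed to deviate by `t / 2`.
  · set B : ι → ι → ℂ := fun i j => if i = j then 0 else A i j with hB
    set ξ : ι → Ω → ℂ := fun i ω => ((‖x i ω‖ ^ 2 - v i : ℝ) : ℂ) with hξ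
    have hv0 : ∀ i, 0 ≤ v i := fun i => by
      rw [← hv i]; exact integral_nonneg fun ω => by positivity
    have hBF : ∑ i, ∑ j, ‖B i j‖ ^ 2 ≤ F := by
      rw [hF]
      gcongr with i _ j _
      simp only [hB]
      split_ifs <;> simp
    have hdF : ∑ i, ‖A i i‖ ^ 2 ≤ F := by
      rw [hF]
      gcongr with i _
      exact Finset.single_le_sum (f := fun j => ‖A i j‖ ^ 2) (fun j _ => by positivity)
        (Finset.mem_univ i)
    have hξmom : ∀ i, HasMoments (ξ i) μ := fun i => by
      have := ((hmom i).mul (hmom i).conj').add (HasMoments.const (-(v i : ℂ)))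
      convert this using 2 with ω
      simp only [hξ]
      rw [Complex.mul_conj, Complex.normSq_eq_norm_sq]
      push_cast
      ring
    have hξm : ∀ i, Measurable (ξ i) := fun i => by have := hm i; simp only [hξ]; fun_prop
    have hξind : iIndepFun ξ μ := hind.comp (fun i z => ((‖z‖ ^ 2 - v i : ℝ) : ℂ))
      (fun i => by fun_prop)
    have hξ0 : ∀ i, ∫ ω, ξ i ω ∂μ = 0 := fun i => by
      simp only [hξ]
      rw [integral_complex_ofReal, integral_sub ((hmom i).integrable_norm_pow 2) (integrable_const _), hv i]
      simp
    have b1 : μ.real {ω | t / 2 * Real.sqrt F < ‖∑ i, ∑ j, B i j * x i ω * conj (x j ω)‖}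
        ≤ deviation k c t := by
      refine measureReal_norm_gt_le (HasMoments.sum _ fun i _ => HasMoments.sum _ fun j _ =>
        ((HasMoments.const _).mul (hmom i)).mul (hmom j).conj')
        (momentConst_pos hk c) h (g := 4 * k + 2) (by omega) (fun q => ?_) (by positivity)
      refine (integral_norm_quadratic_pow_le hind hm hmom h0 q (by positivity)
        (fun i => (htail i).integral_even_le (hm i) hk hc q) B (by simp [hB]) h hBF).trans ?_
      exact pow_le_pow_left₀ (by positivity) (quadratic_moment_aux hk q h) _
    have b2 : μ.real {ω | t / 2 * Real.sqrt F < ‖∑ i, A i i * ξ i ω‖} ≤ deviation k c t := by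
      refine measureReal_norm_gt_le (HasMoments.sum _ fun i _ => (HasMoments.const _).mul (hξmom i))
        (momentConst_pos hk c) h (g := 4 * k + 2) (by omega) (fun q => ?_) (by positivity)
      refine (integral_norm_linear_pow_le hξind hξm hξmom hξ0 q (by positivity)
        (fun i => (htail i).integral_sq_sub_le (hm i) hk hc q (hv0 i) (hv1 i)) (fun i => A i i) h
        Finset.univ hdF).trans ?_
      exact pow_le_pow_left₀ (by positivity) (diagonal_moment_aux hk hc q h) _
    have hdec : ∀ ω, ∑ i, ∑ j, A i j * x i ω * conj (x j ω) - ∑ i, A i i * v i =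
        ∑ i, ∑ j, B i j * x i ω * conj (x j ω) + ∑ i, A i i * ξ i ω := by
      intro ω
      rw [sub_eq_iff_eq_add, add_assoc, ← Finset.sum_add_distrib, ← Finset.sum_add_distrib]
      refine Finset.sum_congr rfl fun i _ => ?_
      have e1 : ∀ j, A i j * x i ω * conj (x j ω) = B i j * x i ω * conj (x j ω) +
          if i = j then A i i * x i ω * conj (x i ω) else 0 := fun j => by
        simp only [hB]
        split_ifs with hij
        · subst hij; simp
        · simp
      rw [Finset.sum_congr rfl fun j _ => e1 j]
      simp only [Finset.sum_add_distrib, Finset.sum_ite_eq, Finset.mem_univ, if_true, hξ]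
      rw [mul_assoc (A i i), Complex.mul_conj, Complex.normSq_eq_norm_sq]
      push_cast
      ring
    have hsub : {ω | t * Real.sqrt F <
        ‖∑ i, ∑ j, A i j * x i ω * conj (x j ω) - ∑ i, A i i * v i‖} ⊆
        {ω | t / 2 * Real.sqrt F < ‖∑ i, ∑ j, B i j * x i ω * conj (x j ω)‖} ∪
        {ω | t / 2 * Real.sqrt F < ‖∑ i, A i i * ξ i ω‖} := by
      intro ω hω
      rw [Set.mem_ofPred_eq, hdec ω] at hω
      simp only [Set.mem_ofPred_eq, Set.mem_union]
      by_contra! hcon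
      have := norm_add_le (∑ i, ∑ j, B i j * x i ω * conj (x j ω)) (∑ i, A i i * ξ i ω)
      linarith [hcon.1, hcon.2]
    calc _ ≤ _ := measureReal_mono hsub
      _ ≤ _ := measureReal_union_le _ _
      _ ≤ _ := by linarith

end Concentration

end

/-! ### Resolvent identities, Ward identities and the Schur complement. -/

section

variable {n : ℕ} {W : Matrix (Fin n) (Fin n) ℂ} {z : ℂ}

section Resolvent

/-- A kernel vector satisfies `W v = z v`; since `v* W v` is real, `Im z * ‖v‖ ^ 2 = 0`. -/
lemma isUnit_det_sub (hW : W.IsHermitian) (hz : 0 < z.im) :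
    IsUnit (W - z • (1 : Matrix (Fin n) (Fin n) ℂ)).det := by
  rw [isUnit_iff_ne_zero]
  intro h
  obtain ⟨v, hv, hv0⟩ := Matrix.exists_mulVec_eq_zero_iff.2 h
  rw [Matrix.sub_mulVec, Matrix.smul_mulVec, Matrix.one_mulVec, sub_eq_zero] at hv0
  have h1 := hW.im_star_dotProduct_mulVec_self v
  rw [hv0, dotProduct_smul, smul_eq_mul] at h1
  have h2 : star v ⬝ᵥ v = ((∑ i, ‖v i‖ ^ 2 : ℝ) : ℂ) := by
    simp only [dotProduct, Pi.star_apply]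
    push_cast
    refine Finset.sum_congr rfl fun i _ => ?_
    rw [Complex.star_def, ← Complex.normSq_eq_conj_mul_self, Complex.normSq_eq_norm_sq]
    push_cast
    rfl
  rw [h2] at h1
  simp only [RCLike.im_eq_complex_im, Complex.im_mul_ofReal] at h1
  have h3 : ∑ i, ‖v i‖ ^ 2 = 0 := by
    rcases mul_eq_zero.1 h1 with h | h
    · exact absurd h hz.ne'
    · exact h
  apply hv
  ext i
  have := (Finset.sum_eq_zero_iff_of_nonneg fun i _ => sq_nonneg ‖v i‖).1 h3 i (Finset.mem_univ i)
  simpa using this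

lemma resolvent_mul (hW : W.IsHermitian) (hz : 0 < z.im) :
    resolventMatrix W z * (W - z • 1) = 1 :=
  Matrix.nonsing_inv_mul _ (isUnit_det_sub hW hz)

lemma mul_resolvent (hW : W.IsHermitian) (hz : 0 < z.im) :
    (W - z • 1) * resolventMatrix W z = 1 :=
  Matrix.mul_nonsing_inv _ (isUnit_det_sub hW hz)

/-- The resolvent identity, stated with one-sided inverses so that it covers a change of `z`, the
adjoint, and the removal of a row and column. -/
lemma sub_eq_mul_sub_mul {A A' R R' : Matrix (Fin n) (Fin n) ℂ} (h : R * A = 1)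
    (h' : A' * R' = 1) : R - R' = R * (A' - A) * R' := by
  rw [mul_sub, sub_mul, h, mul_assoc, h']
  simp

lemma conjTranspose_sub (hW : W.IsHermitian) :
    (W - z • (1 : Matrix (Fin n) (Fin n) ℂ))ᴴ = W - conj z • 1 := by
  rw [Matrix.conjTranspose_sub, Matrix.conjTranspose_smul, hW.eq, Matrix.conjTranspose_one]
  rfl

lemma sub_conj_eq (z : ℂ) : z - conj z = 2 * z.im * Complex.I := by
  rw [Complex.sub_conj]; push_cast; ring

/-- With `A = W - z`, the resolvent identity gives `R - Rᴴ = R (Aᴴ - A) Rᴴ`, and `Aᴴ - A = z - conj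
z` is scalar. The diagonal entries are the Ward identity. -/
lemma resolvent_sub_conjTranspose (hW : W.IsHermitian) (hz : 0 < z.im) :
    resolventMatrix W z - (resolventMatrix W z)ᴴ
      = (2 * z.im * Complex.I) • (resolventMatrix W z * (resolventMatrix W z)ᴴ) := by
  have h : (W - z • (1 : Matrix (Fin n) (Fin n) ℂ))ᴴ * (resolventMatrix W z)ᴴ = 1 := by
    rw [← Matrix.conjTranspose_mul, resolvent_mul hW hz, Matrix.conjTranspose_one]
  rw [sub_eq_mul_sub_mul (resolvent_mul hW hz) h, conjTranspose_sub hW, ← sub_conj_eq,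
    sub_sub_sub_cancel_left, ← sub_smul]
  simp

lemma resolvent_sub_conjTranspose' (hW : W.IsHermitian) (hz : 0 < z.im) :
    resolventMatrix W z - (resolventMatrix W z)ᴴ
      = (2 * z.im * Complex.I) • ((resolventMatrix W z)ᴴ * resolventMatrix W z) := by
  have h : (resolventMatrix W z)ᴴ * (W - z • (1 : Matrix (Fin n) (Fin n) ℂ))ᴴ = 1 := by
    rw [← Matrix.conjTranspose_mul, mul_resolvent hW hz, Matrix.conjTranspose_one]
  rw [← neg_sub, sub_eq_mul_sub_mul h (mul_resolvent hW hz), conjTranspose_sub hW, ← sub_conj_eq,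
    sub_sub_sub_cancel_left, ← sub_smul, mul_smul_comm, mul_one, smul_mul_assoc, ← neg_smul, neg_sub]

lemma im_eq_of_sub_conj_eq {s η : ℝ} {w : ℂ} (h : w - conj w = (2 * (η : ℂ) * Complex.I) * (s : ℂ)) :
    w.im = η * s := by
  rw [sub_conj_eq] at h
  have := congrArg Complex.im h
  simp at this
  linarith

/-- Ward identity along rows. -/
lemma ward_row (hW : W.IsHermitian) (hz : 0 < z.im) (i : Fin n) :
    ∑ k, ‖resolventMatrix W z i k‖ ^ 2 = (resolventMatrix W z i i).im / z.im := by
  rw [eq_div_iff hz.ne', mul_comm]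
  symm
  have h := congrFun (congrFun (resolvent_sub_conjTranspose hW hz) i) i
  rw [Matrix.sub_apply, Matrix.conjTranspose_apply, Matrix.smul_apply, Matrix.mul_apply,
    smul_eq_mul] at h
  refine im_eq_of_sub_conj_eq (h.trans ?_)
  congr 1
  push_cast
  refine Finset.sum_congr rfl fun k _ => ?_
  rw [Matrix.conjTranspose_apply, Complex.star_def, Complex.mul_conj, Complex.normSq_eq_norm_sq]
  push_cast
  rfl

/-- Ward identity along columns. -/
lemma ward_col (hW : W.IsHermitian) (hz : 0 < z.im) (i : Fin n) :
    ∑ k, ‖resolventMatrix W z k i‖ ^ 2 = (resolventMatrix W z i i).im / z.im := by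
  rw [eq_div_iff hz.ne', mul_comm]
  symm
  have h := congrFun (congrFun (resolvent_sub_conjTranspose' hW hz) i) i
  rw [Matrix.sub_apply, Matrix.conjTranspose_apply, Matrix.smul_apply, Matrix.mul_apply,
    smul_eq_mul] at h
  refine im_eq_of_sub_conj_eq (h.trans ?_)
  congr 1
  push_cast
  refine Finset.sum_congr rfl fun k _ => ?_
  rw [Matrix.conjTranspose_apply, Complex.star_def, ← Complex.normSq_eq_conj_mul_self,
    Complex.normSq_eq_norm_sq]
  push_cast
  rfl

lemma resolvent_diag_im_nonneg (hW : W.IsHermitian) (hz : 0 < z.im) (i : Fin n) :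
    0 ≤ (resolventMatrix W z i i).im := by
  have h := ward_row hW hz i
  have h0 : 0 ≤ ∑ k, ‖resolventMatrix W z i k‖ ^ 2 := by positivity
  rw [h] at h0
  by_contra! hc
  exact absurd h0 (not_le.2 (div_neg_of_neg_of_pos hc hz))

/-- The Ward identity gives `‖R i j‖ ^ 2 ≤ ‖R i i‖ / η`. Taking `j = i` bounds the diagonal, and
then every entry. -/
lemma norm_resolvent_le (hW : W.IsHermitian) (hz : 0 < z.im) (i j : Fin n) :
    ‖resolventMatrix W z i j‖ ≤ 1 / z.im := by
  have h1 : ∀ j, ‖resolventMatrix W z i j‖ ^ 2 ≤ ‖resolventMatrix W z i i‖ / z.im := fun j =>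
    calc _ ≤ ∑ k, ‖resolventMatrix W z i k‖ ^ 2 :=
          Finset.single_le_sum (f := fun k => ‖resolventMatrix W z i k‖ ^ 2)
            (fun k _ => by positivity) (Finset.mem_univ j)
      _ = _ := ward_row hW hz i
      _ ≤ _ := by gcongr; exact (le_abs_self _).trans (Complex.abs_im_le_norm _)
  have h2 : ‖resolventMatrix W z i i‖ ≤ 1 / z.im := by
    by_contra! hc
    have h3 := h1 i
    have : 0 < 1 / z.im := by positivity
    rw [div_eq_mul_one_div] at h3
    nlinarith
  refine le_of_sq_le_sq ?_ (by positivity)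
  refine (h1 j).trans ?_
  rw [sq, ← div_eq_mul_one_div]
  gcongr

lemma sum_norm_mul_norm_le {ι : Type*} [Fintype ι] (a b : ι → ℂ) :
    ∑ k, ‖a k‖ * ‖b k‖ ≤ Real.sqrt (∑ k, ‖a k‖ ^ 2) * Real.sqrt (∑ k, ‖b k‖ ^ 2) :=
  Real.sum_mul_le_sqrt_mul_sqrt _ _ _

/-- Halving the imaginary part at most doubles the entries of the resolvent. -/
lemma norm_resolvent_half_le (hW : W.IsHermitian) {z' : ℂ} (hz : 0 < z.im) (hre : z'.re = z.re)
    (him : z'.im = 2 * z.im) {K : ℝ} (hK : ∀ i j, ‖resolventMatrix W z' i j‖ ≤ K) (i j : Fin n) :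
    ‖resolventMatrix W z i j‖ ≤ 2 * K := by
  have hz' : 0 < z'.im := by rw [him]; positivity
  have hK0 : 0 ≤ K := (norm_nonneg _).trans (hK i j)
  obtain ⟨⟨i0, j0⟩, -, hmax⟩ := Finset.exists_max_image Finset.univ
    (fun p : Fin n × Fin n => ‖resolventMatrix W z p.1 p.2‖) ⟨(i, j), Finset.mem_univ _⟩
  refine (hmax (i, j) (Finset.mem_univ _)).trans ?_
  set Γ := ‖resolventMatrix W z i0 j0‖ with hΓ
  have hΓ' : ∀ i j, ‖resolventMatrix W z i j‖ ≤ Γ := fun i j => hmax (i, j) (Finset.mem_univ _)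
  have hΓ0 : 0 ≤ Γ := norm_nonneg _
  have hzz : z - z' = -(z.im : ℂ) * Complex.I := by
    apply Complex.ext <;> simp [hre, him]
    ring
  have hid := congrFun (congrFun (sub_eq_mul_sub_mul (resolvent_mul hW hz) (mul_resolvent hW hz'))
    i0) j0
  rw [sub_sub_sub_cancel_left, ← sub_smul, hzz, mul_smul_comm, mul_one, smul_mul_assoc,
    Matrix.sub_apply, Matrix.smul_apply, Matrix.mul_apply, smul_eq_mul, sub_eq_iff_eq_add] at hid
  have h1 : ‖∑ k, resolventMatrix W z i0 k * resolventMatrix W z' k j0‖ ≤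
      Real.sqrt (Γ / z.im) * Real.sqrt (K / z'.im) := by
    calc _ ≤ ∑ k, ‖resolventMatrix W z i0 k‖ * ‖resolventMatrix W z' k j0‖ := by
          refine (norm_sum_le _ _).trans (le_of_eq ?_)
          simp
      _ ≤ _ := sum_norm_mul_norm_le _ _
      _ ≤ _ := by
          rw [ward_row hW hz, ward_col hW hz']
          gcongr
          · exact (le_abs_self _).trans ((Complex.abs_im_le_norm _).trans (hΓ' _ _))
          · exact (le_abs_self _).trans ((Complex.abs_im_le_norm _).trans (hK _ _))
  -- For the largest entry `Γ`, Cauchy–Schwarz and Ward give `Γ ≤ √(Γ K / 2) + K`; if `Γ > 2 K` the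
  -- root is at most `Γ / 2`, which forces `Γ ≤ 2 K`.
  by_contra! hcon
  have h2 : z.im * (Real.sqrt (Γ / z.im) * Real.sqrt (K / z'.im)) ≤ Γ / 2 := by
    rw [← Real.sqrt_mul (by positivity), him]
    have : Γ / z.im * (K / (2 * z.im)) ≤ (Γ / 2 / z.im) ^ 2 := by
      rw [div_mul_div_comm, div_pow, div_le_div_iff₀ (by positivity) (by positivity)]
      have : Γ * K ≤ Γ * (Γ / 2) := by gcongr; linarith
      have h5 : 0 < z.im ^ 2 := by positivity
      nlinarith
    have h4 := Real.sqrt_le_sqrt this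
    rw [Real.sqrt_sq (by positivity)] at h4
    calc _ ≤ z.im * (Γ / 2 / z.im) := by gcongr
      _ = _ := by field_simp
  have h3 : Γ ≤ z.im * (Real.sqrt (Γ / z.im) * Real.sqrt (K / z'.im)) + K := by
    refine (congrArg norm hid).le.trans ((norm_add_le _ _).trans ?_)
    gcongr
    · rw [norm_mul, norm_mul, norm_neg, Complex.norm_I, mul_one, Complex.norm_real,
        Real.norm_of_nonneg hz.le]
      gcongr
    · exact hK _ _
  linarith

end Resolvent

section Minor

/-- The matrix `W` with row and column `i` replaced by zero. -/
def minor (W : Matrix (Fin n) (Fin n) ℂ) (i : Fin n) : Matrix (Fin n) (Fin n) ℂ :=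
  Matrix.of fun k l => if k = i ∨ l = i then 0 else W k l

/-- Row `i` of `W` with the diagonal entry replaced by zero. -/
def offDiagRow (W : Matrix (Fin n) (Fin n) ℂ) (i : Fin n) : Fin n → ℂ :=
  fun l => if l = i then 0 else W i l

lemma minor_isHermitian (hW : W.IsHermitian) (i : Fin n) : (minor W i).IsHermitian := by
  ext k l
  simp only [minor, Matrix.conjTranspose_apply, Matrix.of_apply]
  by_cases h : k = i ∨ l = i
  · rw [if_pos h, if_pos h.symm, star_zero]
  · rw [if_neg h, if_neg fun h' => h h'.symm, hW.apply]

variable (i : Fin n)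

/-- The minor keeps the size `n`, so no reindexing is needed. Its zero row decouples index `i`, at
the cost of a spurious entry `-1 / z` in its resolvent. -/
lemma resolvent_minor_row (hW : W.IsHermitian) (hz : 0 < z.im) (j : Fin n) :
    -z * resolventMatrix (minor W i) z i j = if i = j then 1 else 0 := by
  have h := congrFun (congrFun (mul_resolvent (minor_isHermitian hW i) hz) i) j
  rw [Matrix.mul_apply, Matrix.one_apply] at h
  rw [← h, Finset.sum_eq_single i]
  · simp [minor]
  · intro k _ hk
    simp [minor, Ne.symm hk]
  · simp

lemma resolvent_minor_row_eq_zero (hW : W.IsHermitian) (hz : 0 < z.im) {j : Fin n} (hj : j ≠ i) :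
    resolventMatrix (minor W i) z i j = 0 := by
  have h := resolvent_minor_row i hW hz j
  rw [if_neg (Ne.symm hj)] at h
  refine (mul_eq_zero.1 h).resolve_left fun h0 => ?_
  rw [neg_eq_zero] at h0
  simp [h0] at hz

lemma norm_resolvent_minor_self_le (hW : W.IsHermitian) (hz : 0 < z.im) :
    ‖resolventMatrix (minor W i) z i i‖ ≤ 1 / z.im :=
  norm_resolvent_le (minor_isHermitian hW i) hz i i

/-- In `R - R' = R (W' - W) R'` the perturbation lives on row and column `i`. Column `i` meets row
`i` of `R'`, which vanishes at `j ≠ i`, so only row `i` of `W` survives. -/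
lemma resolvent_eq_minor_sub (hW : W.IsHermitian) (hz : 0 < z.im) {j : Fin n} (hj : j ≠ i)
    (k : Fin n) : resolventMatrix W z k j = resolventMatrix (minor W i) z k j
      - resolventMatrix W z k i * ∑ l, offDiagRow W i l * resolventMatrix (minor W i) z l j := by
  have h := congrFun (congrFun (sub_eq_mul_sub_mul (resolvent_mul hW hz)
    (mul_resolvent (minor_isHermitian hW i) hz)) k) j
  rw [sub_sub_sub_cancel_right, mul_assoc, Matrix.sub_apply, Matrix.mul_apply,
    Finset.sum_eq_single i] at h
  · rw [sub_eq_iff_eq_add] at h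
    rw [h, add_comm, sub_eq_add_neg (resolventMatrix (minor W i) z k j), ← mul_neg, Matrix.mul_apply, ← Finset.sum_neg_distrib]
    congr 2
    refine Finset.sum_congr rfl fun l _ => ?_
    by_cases hl : l = i
    · subst hl
      rw [resolvent_minor_row_eq_zero l hW hz hj]
      simp
    · simp [minor, offDiagRow, hl]
  · intro p _ hp
    rw [Matrix.mul_apply, Finset.sum_eq_zero, mul_zero]
    intro l _
    by_cases hl : l = i
    · subst hl
      rw [resolvent_minor_row_eq_zero l hW hz hj, mul_zero]
    · simp [minor, hp, hl]
  · simp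

lemma resolvent_offDiag_eq (hW : W.IsHermitian) (hz : 0 < z.im) {j : Fin n} (hj : j ≠ i) :
    resolventMatrix W z i j = -(resolventMatrix W z i i *
      ∑ l, offDiagRow W i l * resolventMatrix (minor W i) z l j) := by
  rw [resolvent_eq_minor_sub i hW hz hj, resolvent_minor_row_eq_zero i hW hz hj, zero_sub]

/-- The usual `R_kj - R'_kj = R_ki R_ij / R_ii`, cleared of its denominator. -/
lemma resolvent_mul_sub_minor (hW : W.IsHermitian) (hz : 0 < z.im) {j : Fin n} (hj : j ≠ i)
    (k : Fin n) :
    resolventMatrix W z i i * (resolventMatrix W z k j - resolventMatrix (minor W i) z k j)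
      = resolventMatrix W z k i * resolventMatrix W z i j := by
  rw [resolvent_offDiag_eq i hW hz hj, resolvent_eq_minor_sub i hW hz hj k]
  ring

/-- Schur complement formula for a diagonal entry. -/
lemma schur_complement (hW : W.IsHermitian) (hz : 0 < z.im) :
    resolventMatrix W z i i * (W i i - z - ∑ l, ∑ k, resolventMatrix (minor W i) z l k *
      offDiagRow W i l * conj (offDiagRow W i k)) = 1 := by
  have h := congrFun (congrFun (resolvent_mul hW hz) i) i
  rw [Matrix.mul_apply, Matrix.one_apply_eq,
    ← Finset.add_sum_erase _ _ (Finset.mem_univ i)] at h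
  rw [← h, mul_sub, sub_eq_add_neg]
  congr 1
  · simp
  · rw [Finset.sum_comm, Finset.mul_sum, ← Finset.sum_neg_distrib,
      ← Finset.add_sum_erase _ _ (Finset.mem_univ i)]
    simp only [offDiagRow, if_true, map_zero, mul_zero, Finset.sum_const_zero, neg_zero, zero_add]
    refine Finset.sum_congr rfl fun k hk => ?_
    have hki : k ≠ i := Finset.ne_of_mem_erase hk
    rw [resolvent_offDiag_eq i hW hz hki]
    simp only [hki, if_false, Matrix.sub_apply, Matrix.smul_apply, Matrix.one_apply_ne hki,
      smul_zero, sub_zero, offDiagRow, ← hW.apply k i, Complex.star_def]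
    rw [neg_mul, neg_inj, mul_assoc, Finset.sum_mul]
    congr 1
    refine Finset.sum_congr rfl fun l _ => ?_
    ring

end Minor

end

/-! ### The self-consistent equation and one step of the bootstrap. -/

section

variable {n : ℕ} {W : Matrix (Fin n) (Fin n) ℂ} {z : ℂ}

lemma resolvent_diag_ne_zero (hW : W.IsHermitian) (hz : 0 < z.im) (i : Fin n) :
    resolventMatrix W z i i ≠ 0 :=
  left_ne_zero_of_mul_eq_one (schur_complement i hW hz)

lemma resolvent_diag_im_le_norm (W : Matrix (Fin n) (Fin n) ℂ) (z : ℂ) (i : Fin n) :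
    (resolventMatrix W z i i).im ≤ ‖resolventMatrix W z i i‖ :=
  (le_abs_self _).trans (Complex.abs_im_le_norm _)

/-- The trace of the resolvent changes by at most `1 / η` when a row and column are removed. -/
lemma norm_trace_minor_sub_le (hW : W.IsHermitian) (hz : 0 < z.im) (i : Fin n) :
    ‖∑ l, (if l = i then 0 else resolventMatrix (minor W i) z l l) - ∑ l, resolventMatrix W z l l‖
      ≤ 1 / z.im := by
  have hne := resolvent_diag_ne_zero hW hz i
  -- After multiplication by `R_ii` the trace difference is `∑ R_li R_il`, the term `l = i`
  -- included. Cauchy–Schwarz and both Ward identities bound it by `Im R_ii / η`, and `R_ii`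
  -- cancels.
  have h : resolventMatrix W z i i * (∑ l, resolventMatrix W z l l -
      ∑ l, (if l = i then 0 else resolventMatrix (minor W i) z l l)) =
      ∑ l, resolventMatrix W z l i * resolventMatrix W z i l := by
    rw [← Finset.sum_sub_distrib, Finset.mul_sum]
    refine Finset.sum_congr rfl fun l _ => ?_
    split_ifs with hl
    · rw [hl, sub_zero]
    · rw [resolvent_mul_sub_minor i hW hz hl]
  have h2 : ‖∑ l, resolventMatrix W z l i * resolventMatrix W z i l‖ ≤
      ‖resolventMatrix W z i i‖ * (1 / z.im) := by
    calc _ ≤ ∑ l, ‖resolventMatrix W z l i‖ * ‖resolventMatrix W z i l‖ := by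
          refine (norm_sum_le _ _).trans (le_of_eq ?_)
          simp
      _ ≤ _ := sum_norm_mul_norm_le _ _
      _ = (resolventMatrix W z i i).im / z.im := by
          rw [ward_row hW hz, ward_col hW hz, Real.mul_self_sqrt]
          exact div_nonneg (resolvent_diag_im_nonneg hW hz i) hz.le
      _ ≤ _ := by
          rw [← div_eq_mul_one_div]
          gcongr
          exact resolvent_diag_im_le_norm W z i
  rw [← h, norm_mul] at h2
  rw [norm_sub_rev]
  exact le_of_mul_le_mul_left h2 (norm_pos_iff.2 hne)

/-- Ward's identity turns the Frobenius norm into a trace. One `1 / η` is the change of trace, the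
other the spurious `(i, i)` entry of the minor's resolvent. -/
lemma sum_sum_norm_sq_minor_le (hW : W.IsHermitian) (hz : 0 < z.im) (i : Fin n) :
    ∑ l, ∑ k, ‖resolventMatrix (minor W i) z l k‖ ^ 2 ≤
      (2 / z.im + ‖∑ l, resolventMatrix W z l l‖) / z.im := by
  have hM := minor_isHermitian hW i
  simp only [ward_row hM hz]
  rw [← Finset.sum_div]
  gcongr
  have h1 := norm_trace_minor_sub_le hW hz i
  have h2 := norm_resolvent_minor_self_le i hW hz
  have h3 : ∑ l, resolventMatrix (minor W i) z l l = resolventMatrix (minor W i) z i i +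
      ∑ l, (if l = i then 0 else resolventMatrix (minor W i) z l l) := by
    rw [← Finset.add_sum_erase _ _ (Finset.mem_univ i),
      ← Finset.add_sum_erase _ (fun l => if l = i then 0 else _) (Finset.mem_univ i)]
    simp only [if_true, zero_add]
    congr 1
    exact Finset.sum_congr rfl fun l hl => by rw [if_neg (Finset.ne_of_mem_erase hl)]
  calc ∑ l, (resolventMatrix (minor W i) z l l).im
      = (∑ l, resolventMatrix (minor W i) z l l).im := (Complex.im_sum _ _).symm
    _ ≤ ‖∑ l, resolventMatrix (minor W i) z l l‖ :=
        (le_abs_self _).trans (Complex.abs_im_le_norm _)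
    _ ≤ ‖resolventMatrix (minor W i) z i i‖ + (‖∑ l, (if l = i then 0 else
          resolventMatrix (minor W i) z l l) - ∑ l, resolventMatrix W z l l‖ +
          ‖∑ l, resolventMatrix W z l l‖) := by
        rw [h3]
        refine (norm_add_le _ _).trans ?_
        gcongr
        exact norm_le_norm_sub_add _ _
    _ ≤ 1 / z.im + (1 / z.im + ‖∑ l, resolventMatrix W z l l‖) := by gcongr
    _ = _ := by ring

lemma norm_resolvent_minor_diag_le (hW : W.IsHermitian) (hz : 0 < z.im) {i j : Fin n} (hj : j ≠ i) :
    ‖resolventMatrix (minor W i) z j j‖ ≤ ‖resolventMatrix W z j j‖ +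
      ‖resolventMatrix W z j i‖ * ‖resolventMatrix W z i j‖ * ‖resolventMatrix W z i i‖⁻¹ := by
  have h := resolvent_mul_sub_minor i hW hz hj j
  have hne := resolvent_diag_ne_zero hW hz i
  have : resolventMatrix (minor W i) z j j = resolventMatrix W z j j -
      resolventMatrix W z j i * resolventMatrix W z i j * (resolventMatrix W z i i)⁻¹ := by
    rw [← h]; field_simp; ring
  rw [this]
  refine (norm_sub_le _ _).trans (le_of_eq ?_)
  rw [norm_mul, norm_mul, norm_inv]

/-- The approximate self-consistent equation `s (z + s) = -1` confines `s`. -/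
lemma self_consistent_bounds {s : ℂ} {B : ℝ} (hB : 0 ≤ B) (hz : ‖z‖ ≤ B + 1)
    (h : ‖s * (z + s) + 1‖ ≤ 1 / 2) : ‖s‖ ≤ B + 3 ∧ 1 / (2 * (B + 3)) ≤ ‖z + s‖ := by
  have h1 : ‖s‖ * ‖z + s‖ ≤ 3 / 2 := by
    rw [← norm_mul]
    have := norm_sub_le (s * (z + s) + 1) 1
    rw [add_sub_cancel_right, norm_one] at this
    linarith
  have h2 : 1 / 2 ≤ ‖s‖ * ‖z + s‖ := by
    rw [← norm_mul]
    have := norm_sub_le (s * (z + s) + 1) (s * (z + s))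
    rw [add_sub_cancel_left, norm_one] at this
    linarith
  have h3 : ‖s‖ - ‖z‖ ≤ ‖z + s‖ := by
    have := norm_sub_le (z + s) z
    rw [add_sub_cancel_left] at this
    linarith
  have hs : ‖s‖ ≤ B + 3 := by
    by_contra! hc
    have : 2 ≤ ‖z + s‖ := by linarith
    nlinarith [norm_nonneg s]
  refine ⟨hs, ?_⟩
  rw [div_le_iff₀ (by positivity)]
  have := mul_le_mul_of_nonneg_right hs (norm_nonneg (z + s))
  linarith

/-- One step of the bootstrap: an a priori bound `2 K` on the entries of the resolvent improves to
`K`, provided the relevant linear and quadratic forms are close to their means. -/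
lemma norm_resolvent_le_of_fluctuation (hW : W.IsHermitian) {B K δ : ℝ} (hB : 0 ≤ B)
    (hK : K = 4 * (B + 3)) (hδ : δ = 1 / (24 * K ^ 2)) (hre : |z.re| ≤ B) (hz : 0 < z.im)
    (hz1 : z.im ≤ 1) (hn : 8 * K ≤ n * z.im)
    (hap : ∀ i j, ‖resolventMatrix W z i j‖ ≤ 2 * K)
    (hdiag : ∀ i, ‖W i i‖ ≤ δ)
    (hquad : ∀ i, ‖∑ l, ∑ k, resolventMatrix (minor W i) z l k * offDiagRow W i l
        * conj (offDiagRow W i k)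
        - (∑ l, if l = i then 0 else resolventMatrix (minor W i) z l l) / n‖ ≤
      δ * Real.sqrt (n * z.im) *
        Real.sqrt (∑ l, ∑ k, ‖resolventMatrix (minor W i) z l k‖ ^ 2) / n)
    (hlin : ∀ i j, ‖∑ l, offDiagRow W i l * resolventMatrix (minor W i) z l j‖ ≤
      δ * Real.sqrt (n * z.im) *
        Real.sqrt (∑ l, ‖resolventMatrix (minor W i) z l j‖ ^ 2) / Real.sqrt n)
    (i j : Fin n) : ‖resolventMatrix W z i j‖ ≤ K := by
  have hK12 : 12 ≤ K := by rw [hK]; linarith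
  have hδ0 : 0 < δ := by rw [hδ]; positivity
  have hn0 : (0 : ℝ) < n := by
    by_contra! hc
    nlinarith
  have hnC : (n : ℂ) ≠ 0 := by exact_mod_cast hn0.ne'
  set s : ℂ := (∑ l, resolventMatrix W z l l) / n with hs
  -- The error in Schur's formula: diagonal entry, fluctuation of the quadratic form, and change of
  -- trace. They are bounded by `δ`, `2 K δ` and `1 / (n η)`; the choice of `δ` and `n η ≥ 8 K` make
  -- the sum at most `1 / (4 K)`.
  set ε : Fin n → ℂ := fun i => W i i - (∑ l, ∑ k, resolventMatrix (minor W i) z l k *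
    offDiagRow W i l * conj (offDiagRow W i k) - s) with hε
  have hschur : ∀ i, resolventMatrix W z i i * (z + s - ε i) = -1 := fun i => by
    rw [← schur_complement i hW hz, hε]; ring
  have hinv : 1 / (n * z.im) ≤ 1 / (8 * K) := by gcongr
  have htr : ‖∑ l, resolventMatrix W z l l‖ ≤ n * (2 * K) := by
    refine (norm_sum_le _ _).trans ((Finset.sum_le_sum fun l _ => hap l l).trans (le_of_eq ?_))
    simp
  have hεb : ∀ i, ‖ε i‖ ≤ 1 / (4 * K) := fun i => by
    have h1 := norm_trace_minor_sub_le hW hz i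
    have h2 : ‖(∑ l, if l = i then 0 else resolventMatrix (minor W i) z l l) / n - s‖ ≤
        1 / (n * z.im) := by
      rw [hs, ← sub_div, norm_div, Complex.norm_natCast, mul_comm, ← div_div]
      gcongr
    have h3 : δ * Real.sqrt (n * z.im) *
        Real.sqrt (∑ l, ∑ k, ‖resolventMatrix (minor W i) z l k‖ ^ 2) / n ≤ δ * (2 * K) := by
      have h4 := sum_sum_norm_sq_minor_le hW hz i
      have h5 : ∑ l, ∑ k, ‖resolventMatrix (minor W i) z l k‖ ^ 2 ≤ (2 * K) ^ 2 * n / z.im := by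
        refine h4.trans ?_
        gcongr
        have : 2 / z.im ≤ 2 * n := by
          rw [div_le_iff₀ hz]
          nlinarith
        have : (2 + 2 * K) * n ≤ (2 * K) ^ 2 * n := by gcongr; nlinarith
        linarith
      have h6 : Real.sqrt (n * z.im) *
          Real.sqrt (∑ l, ∑ k, ‖resolventMatrix (minor W i) z l k‖ ^ 2) ≤ 2 * K * n := by
        rw [← Real.sqrt_mul (by positivity)]
        refine Real.sqrt_le_iff.2 ⟨by positivity, ?_⟩
        calc _ ≤ n * z.im * ((2 * K) ^ 2 * n / z.im) := by gcongr
          _ = _ := by field_simp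
      rw [div_le_iff₀ hn0, mul_assoc δ]
      calc _ ≤ δ * (2 * K * n) := by gcongr
        _ = _ := by ring
    have h7 : ‖ε i‖ ≤ δ + (δ * (2 * K) + 1 / (n * z.im)) := by
      simp only [hε]
      refine (norm_sub_le _ _).trans (add_le_add (hdiag i) ?_)
      refine (norm_sub_le_norm_sub_add_norm_sub _
        ((∑ l, if l = i then 0 else resolventMatrix (minor W i) z l l) / n) _).trans ?_
      exact add_le_add ((hquad i).trans h3) h2
    refine h7.trans ?_
    have h8 : δ + δ * (2 * K) ≤ 1 / (8 * K) := by
      rw [hδ, ← mul_one_add (1 / (24 * K ^ 2)), div_mul_eq_mul_div, one_mul,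
        div_le_div_iff₀ (by positivity) (by positivity)]
      nlinarith
    have : 1 / (4 * K) = 1 / (8 * K) + 1 / (8 * K) := by field_simp; norm_num
    linarith
  have hzB : ‖z‖ ≤ B + 1 := by
    refine (Complex.norm_le_abs_re_add_abs_im z).trans ?_
    rw [abs_of_pos hz]
    linarith
  have hself : ‖s * (z + s) + 1‖ ≤ 1 / 2 := by
    -- The average over `l` of Schur's formula. The a priori bound `2 K` against `1 / (4 K)` gives
    -- exactly `1 / 2`.
    have e : s * (z + s) + 1 = (∑ l, resolventMatrix W z l l * ε l) / n := by
      have : ∀ l, resolventMatrix W z l l * ε l = resolventMatrix W z l l * (z + s) + 1 := fun l => by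
        linear_combination -hschur l
      simp only [this, Finset.sum_add_distrib, ← Finset.sum_mul]
      simp only [Finset.sum_const, Finset.card_univ, Fintype.card_fin, nsmul_eq_mul, mul_one]
      rw [add_div, div_self hnC, hs]
      ring
    rw [e, norm_div, Complex.norm_natCast, div_le_iff₀ hn0]
    refine (norm_sum_le _ _).trans ?_
    calc _ ≤ ∑ _l : Fin n, 2 * K * (1 / (4 * K)) := by
          refine Finset.sum_le_sum fun l _ => ?_
          rw [norm_mul]
          gcongr
          · exact hap l l
          · exact hεb l
      _ = _ := by simp; field_simp; norm_num
  obtain ⟨hsB, hzs⟩ := self_consistent_bounds hB hzB hself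
  have hnormschur : ∀ i, ‖resolventMatrix W z i i‖ * ‖z + s - ε i‖ = 1 := fun i => by
    rw [← norm_mul, hschur, norm_neg, norm_one]
  have hdiagK : ∀ i, ‖resolventMatrix W z i i‖ ≤ K := fun i => by
    have h1 := norm_sub_norm_le (z + s) (ε i)
    have h2 : 1 / K ≤ ‖z + s - ε i‖ := by
      have e1 : 1 / (2 * (B + 3)) = 2 / K := by rw [hK]; field_simp; norm_num
      have e2 : 1 / (4 * K) ≤ 1 / K := by gcongr; linarith
      have e3 : 2 / K = 1 / K + 1 / K := by ring
      linarith [hεb i]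
    have h3 := mul_le_mul_of_nonneg_left h2 (norm_nonneg (resolventMatrix W z i i))
    rw [hnormschur, mul_one_div, div_le_one (by linarith)] at h3
    exact h3
  rcases eq_or_ne j i with rfl | hji
  · exact hdiagK j
  -- A lower bound on `R_ii` is needed since the minor's entries are recovered by dividing by
  -- `R_ii`.
  have hinvK : ‖resolventMatrix W z i i‖⁻¹ ≤ K := by
    rw [inv_eq_of_mul_eq_one_right (hnormschur i)]
    refine (norm_sub_le _ _).trans ?_
    have h1 := norm_add_le z s
    have h2 : 1 / (4 * K) ≤ 1 := by rw [div_le_one (by positivity)]; linarith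
    linarith [hεb i]
  -- Written as a square because its root enters the linear form, where `δ * 3 K ^ 2 = 1 / 8`.
  have hG : ‖resolventMatrix (minor W i) z j j‖ ≤ (3 * K ^ 2) ^ 2 := by
    refine (norm_resolvent_minor_diag_le hW hz hji).trans ?_
    calc _ ≤ 2 * K + (2 * K) * (2 * K) * K := by
          gcongr
          · exact hap _ _
          · exact hap _ _
          · exact hap _ _
      _ ≤ _ := by
          have e1 : K ≤ K ^ 4 := le_self_pow₀ (by linarith) (by norm_num)
          have e2 : K ^ 3 ≤ K ^ 4 := pow_le_pow_right₀ (by linarith) (by norm_num)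
          nlinarith
  have hL : ‖∑ l, offDiagRow W i l * resolventMatrix (minor W i) z l j‖ ≤ 1 := by
    refine (hlin i j).trans ?_
    rw [ward_col (minor_isHermitian hW i) hz, mul_div_assoc, mul_assoc,
      ← mul_div_assoc, ← Real.sqrt_mul (by positivity), ← Real.sqrt_div (by
        have := resolvent_diag_im_nonneg (minor_isHermitian hW i) hz j; positivity)]
    have e : (n : ℝ) * z.im * ((resolventMatrix (minor W i) z j j).im / z.im) / n =
        (resolventMatrix (minor W i) z j j).im := by field_simp
    rw [e]
    calc _ ≤ δ * (3 * K ^ 2) := by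
          gcongr
          exact Real.sqrt_le_iff.2 ⟨by positivity, (resolvent_diag_im_le_norm _ _ _).trans hG⟩
      _ ≤ 1 := by rw [hδ]; field_simp; norm_num
  rw [resolvent_offDiag_eq i hW hz hji, norm_neg, norm_mul]
  calc _ ≤ K * 1 := by
        gcongr
        exact hdiagK i
    _ = K := mul_one K

end

/-! ### Measurability, and independence of a row from its minor. -/

section

section Measurability

variable {n : ℕ}

/-- Cramer's rule: adjugate over determinant. No Hermitian assumption is made, since conditioning
freezes the minor at an arbitrary matrix. -/
lemma measurable_resolvent_entry (z : ℂ) (l k : Fin n) :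
    Measurable fun A : Fin n → Fin n → ℂ => resolventMatrix (normalized (Matrix.of A)) z l k := by
  have hc : Continuous fun A : Fin n → Fin n → ℂ =>
      normalized (Matrix.of A) - z • (1 : Matrix (Fin n) (Fin n) ℂ) := by
    unfold normalized
    have h0 : Continuous fun A : Fin n → Fin n → ℂ => Matrix.of A := continuous_id
    exact (h0.const_smul ((Real.sqrt n : ℂ)⁻¹)).sub continuous_const
  have h1 : Measurable fun A : Fin n → Fin n → ℂ =>
      ((normalized (Matrix.of A) - z • (1 : Matrix (Fin n) (Fin n) ℂ)).det)⁻¹ :=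
    hc.matrix_det.measurable.inv
  have h2 : Measurable fun A : Fin n → Fin n → ℂ =>
      (normalized (Matrix.of A) - z • (1 : Matrix (Fin n) (Fin n) ℂ)).adjugate l k :=
    (hc.matrix_adjugate.matrix_elem l k).measurable
  unfold resolventMatrix
  simp only [Matrix.inv_def, Ring.inverse_eq_inv', Matrix.smul_apply, smul_eq_mul]
  exact h1.mul h2

end Measurability

section Independence

variable {n : ℕ} {Ω : Type*} [MeasurableSpace Ω] {μ : Measure Ω} {σ : ℝ}
  {M : Ω → Matrix (Fin n) (Fin n) ℂ}

/-- The representative above the diagonal of the unordered pair `{k, l}`. -/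
def upper (k l : Fin n) : {p : Fin n × Fin n // p.1 ≤ p.2} :=
  if h : k ≤ l then ⟨(k, l), h⟩ else ⟨(l, k), (not_le.1 h).le⟩

/-- Conjugation for positions below the diagonal. -/
noncomputable def conjBelow (k l : Fin n) (w : ℂ) : ℂ := if k ≤ l then w else conj w

lemma measurable_conjBelow (k l : Fin n) : Measurable (conjBelow k l) := by
  unfold conjBelow
  split_ifs <;> fun_prop

lemma conjBelow_upper {A : Matrix (Fin n) (Fin n) ℂ} (hA : A.IsHermitian) (k l : Fin n) :
    conjBelow k l (A (upper k l).1.1 (upper k l).1.2) = A k l := by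
  unfold conjBelow upper
  split_ifs with h
  · rfl
  · exact hA.apply k l

lemma upper_mem_iff (i k l : Fin n) :
    ((upper k l).1.1 = i ∨ (upper k l).1.2 = i) ↔ (k = i ∨ l = i) := by
  unfold upper
  split_ifs with h
  · rfl
  · exact or_comm

lemma upper_injective (i : Fin n) : Function.Injective (upper i) := by
  intro l l' h
  unfold upper at h
  split_ifs at h with h1 h2 h2 <;> simp only [Subtype.mk.injEq, Prod.mk.injEq] at h
  · exact h.2
  · exact h.2.trans h.1
  · exact h.1.trans h.2
  · exact h.1

lemma measurable_offDiagRow (hM : ∀ i j, Measurable fun ω => M ω i j) (i l : Fin n) :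
    Measurable fun ω => offDiagRow (M ω) i l := by
  unfold offDiagRow
  split_ifs
  · exact measurable_const
  · exact hM i l

lemma measurable_minor (hM : ∀ i j, Measurable fun ω => M ω i j) (i : Fin n) :
    Measurable fun ω => (fun k l => minor (M ω) i k l : Fin n → Fin n → ℂ) := by
  refine measurable_pi_lambda _ fun k => measurable_pi_lambda _ fun l => ?_
  unfold minor
  simp only [Matrix.of_apply]
  split_ifs
  · exact measurable_const
  · exact hM k l

/-- Distinct `l` use distinct positions of the upper triangle, conjugated when `l < i`. -/
lemma iIndepFun_offDiagRow (h : IsWigner μ σ M) (i : Fin n) :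
    iIndepFun (fun l ω => offDiagRow (M ω) i l) μ := by
  have h1 := (h.iIndepFun_upper.precomp (upper_injective i)).comp
    (fun l w => if l = i then 0 else conjBelow i l w) (fun l => by
      by_cases hl : l = i
      · simp [hl]
      · simp only [hl, if_false]; exact measurable_conjBelow i l)
  convert h1 using 2 with l
  ext ω
  simp only [offDiagRow, Function.comp_apply, conjBelow_upper (h.isHermitian ω)]

/-- Row `i` and the minor are functions of disjoint families of upper-triangular entries: the
positions that involve `i` and those that do not. -/
lemma indepFun_offDiagRow_minor (h : IsWigner μ σ M) (i : Fin n) :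
    IndepFun (fun ω l => offDiagRow (M ω) i l)
      (fun ω => (fun k l => minor (M ω) i k l : Fin n → Fin n → ℂ)) μ := by
  set S : Finset {p : Fin n × Fin n // p.1 ≤ p.2} :=
    Finset.univ.filter fun p => p.1.1 = i ∨ p.1.2 = i with hS
  set T : Finset {p : Fin n × Fin n // p.1 ≤ p.2} :=
    Finset.univ.filter fun p => ¬ (p.1.1 = i ∨ p.1.2 = i) with hT
  have hST : Disjoint S T := Finset.disjoint_filter_filter_not _ _ _
  have h1 := h.iIndepFun_upper.indepFun_finset S T hST
    fun p => h.measurable_entry p.1.1 p.1.2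
  have hmS : ∀ l, upper i l ∈ S := fun l => by
    rw [hS, Finset.mem_filter, upper_mem_iff]; simp
  have hmT : ∀ k l, ¬ (k = i ∨ l = i) → upper k l ∈ T := fun k l hkl => by
    rw [hT, Finset.mem_filter, upper_mem_iff]; exact ⟨Finset.mem_univ _, hkl⟩
  have hφ : Measurable fun (y : S → ℂ) (l : Fin n) =>
      if l = i then (0 : ℂ) else conjBelow i l (y ⟨upper i l, hmS l⟩) := by
    refine measurable_pi_lambda _ fun l => ?_
    by_cases hl : l = i
    · simp [hl]
    · simp only [hl, if_false]
      exact (measurable_conjBelow i l).comp (measurable_pi_apply _)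
  have hψ : Measurable fun (y : T → ℂ) (k l : Fin n) =>
      if hkl : k = i ∨ l = i then (0 : ℂ) else conjBelow k l (y ⟨upper k l, hmT k l hkl⟩) := by
    refine measurable_pi_lambda _ fun k => measurable_pi_lambda _ fun l => ?_
    by_cases hkl : k = i ∨ l = i
    · simp [hkl]
    · simp only [hkl, dite_false]
      exact (measurable_conjBelow k l).comp (measurable_pi_apply _)
  have h2 := h1.comp hφ hψ
  convert h2 using 1
  · ext ω l
    simp only [offDiagRow, Function.comp_apply, conjBelow_upper (h.isHermitian ω)]
  · ext ω k l
    simp only [minor, Matrix.of_apply, Function.comp_apply, conjBelow_upper (h.isHermitian ω)]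
    split_ifs <;> rfl

lemma integral_offDiagRow (h : IsWigner μ σ M) (i l : Fin n) :
    ∫ ω, offDiagRow (M ω) i l ∂μ = 0 := by
  unfold offDiagRow
  split_ifs
  · simp
  · exact h.mean_zero i l

lemma integral_norm_sq_offDiagRow (h : IsWigner μ σ M) (i l : Fin n) :
    ∫ ω, ‖offDiagRow (M ω) i l‖ ^ 2 ∂μ = if l = i then 0 else 1 := by
  unfold offDiagRow
  split_ifs with hl
  · simp
  · rcases lt_or_gt_of_ne hl with h1 | h1
    · rw [← h.variance_offDiag l i h1]
      congr 1
      ext ω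
      rw [← (h.isHermitian ω).apply i l, norm_star]
    · exact h.variance_offDiag i l h1

/-- Positivity of `c` makes the tail event of the zero entry empty. -/
lemma HasTail.offDiagRow {k : ℕ} {c : ℝ} (hc : 0 < c)
    (htail : ∀ i j, HasTail (fun ω => M ω i j) μ k c) (i l : Fin n) :
    HasTail (fun ω => offDiagRow (M ω) i l) μ k c := by
  unfold WignerResolvent.offDiagRow
  split_ifs
  · intro t ht
    have : ¬ t ^ k ≤ 0 := not_le.2 (pow_pos (hc.trans_le ht) k)
    simp only [norm_zero, this]
    simp
    exact (Real.exp_pos _).le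
  · exact htail i l

end Independence

end

/-! ### The regular event and its probability. -/

section

section Good

variable {n : ℕ}

/-- The off-diagonal rows of `M` are well behaved with respect to the resolvents of the minors. -/
structure Regular (M : Matrix (Fin n) (Fin n) ℂ) (z : ℂ) (δ t : ℝ) : Prop where
  diag : ∀ i, ‖M i i‖ ≤ δ * Real.sqrt n
  quadratic : ∀ i, ‖∑ l, ∑ k, resolventMatrix (normalized (minor M i)) z l k * offDiagRow M i l
      * conj (offDiagRow M i k) - ∑ l, resolventMatrix (normalized (minor M i)) z l l *
        ((if l = i then 0 else 1 : ℝ) : ℂ)‖ ≤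
      t * Real.sqrt (∑ l, ∑ k, ‖resolventMatrix (normalized (minor M i)) z l k‖ ^ 2)
  linear : ∀ i j, ‖∑ l, resolventMatrix (normalized (minor M i)) z l j * offDiagRow M i l‖ ≤
      t * Real.sqrt (∑ l, ‖resolventMatrix (normalized (minor M i)) z l j‖ ^ 2)

lemma normalized_isHermitian {M : Matrix (Fin n) (Fin n) ℂ} (hM : M.IsHermitian) :
    (normalized M).IsHermitian := by
  unfold normalized
  rw [Matrix.IsHermitian, Matrix.conjTranspose_smul, hM.eq]
  congr 1
  simp

lemma minor_normalized (M : Matrix (Fin n) (Fin n) ℂ) (i : Fin n) :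
    minor (normalized M) i = normalized (minor M i) := by
  ext k l
  simp [minor, normalized]

lemma offDiagRow_normalized (M : Matrix (Fin n) (Fin n) ℂ) (i l : Fin n) :
    offDiagRow (normalized M) i l = (Real.sqrt n : ℂ)⁻¹ * offDiagRow M i l := by
  simp [offDiagRow, normalized]

lemma Regular.norm_resolvent_le {M : Matrix (Fin n) (Fin n) ℂ} (hM : M.IsHermitian) {z : ℂ}
    {B K δ : ℝ} (hB : 0 ≤ B) (hK : K = 4 * (B + 3)) (hδ : δ = 1 / (24 * K ^ 2))
    (hre : |z.re| ≤ B) (hz : 0 < z.im) (hz1 : z.im ≤ 1) (hn : 8 * K ≤ n * z.im)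
    (hap : ∀ i j, ‖resolventMatrix (normalized M) z i j‖ ≤ 2 * K)
    (h : Regular M z δ (δ * Real.sqrt (n * z.im))) (i j : Fin n) :
    ‖resolventMatrix (normalized M) z i j‖ ≤ K := by
  have hn0 : (0 : ℝ) < n := by
    by_contra! hc
    nlinarith
  have hs0 : 0 < Real.sqrt n := Real.sqrt_pos.2 hn0
  have hnorm : ‖(Real.sqrt n : ℂ)⁻¹‖ = (Real.sqrt n)⁻¹ := by
    rw [norm_inv, Complex.norm_real, Real.norm_of_nonneg hs0.le]
  have hsq : (Real.sqrt n : ℂ)⁻¹ * (Real.sqrt n : ℂ)⁻¹ = (n : ℂ)⁻¹ := by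
    rw [← mul_inv, ← Complex.ofReal_mul, Real.mul_self_sqrt hn0.le, Complex.ofReal_natCast]
  refine norm_resolvent_le_of_fluctuation (normalized_isHermitian hM) hB hK hδ hre hz hz1 hn hap
    (fun i => ?_) (fun i => ?_) (fun i j => ?_) i j
  · rw [normalized, Matrix.smul_apply, smul_eq_mul, norm_mul, hnorm, inv_mul_le_iff₀ hs0, mul_comm]
    exact h.diag i
  · simp only [minor_normalized, offDiagRow_normalized]
    have e : ∑ l, ∑ k, resolventMatrix (normalized (minor M i)) z l k *
        ((Real.sqrt n : ℂ)⁻¹ * offDiagRow M i l) * conj ((Real.sqrt n : ℂ)⁻¹ * offDiagRow M i k) -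
        (∑ l, if l = i then 0 else resolventMatrix (normalized (minor M i)) z l l) / n =
        (∑ l, ∑ k, resolventMatrix (normalized (minor M i)) z l k * offDiagRow M i l
      * conj (offDiagRow M i k) - ∑ l, resolventMatrix (normalized (minor M i)) z l l *
        ((if l = i then 0 else 1 : ℝ) : ℂ)) / n := by
      rw [sub_div]
      congr 1
      · rw [div_eq_mul_inv, ← hsq]
        simp only [Finset.sum_mul]
        refine Finset.sum_congr rfl fun l _ => Finset.sum_congr rfl fun k _ => ?_
        rw [map_mul, map_inv₀, Complex.conj_ofReal]
        ring
      · congr 1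
        refine Finset.sum_congr rfl fun l _ => ?_
        split_ifs <;> simp
    rw [e, norm_div, Complex.norm_natCast]
    gcongr
    exact h.quadratic i
  · simp only [minor_normalized, offDiagRow_normalized]
    have e : ∑ l, (Real.sqrt n : ℂ)⁻¹ * offDiagRow M i l *
        resolventMatrix (normalized (minor M i)) z l j = (Real.sqrt n : ℂ)⁻¹ *
        ∑ l, resolventMatrix (normalized (minor M i)) z l j * offDiagRow M i l := by
      rw [Finset.mul_sum]
      refine Finset.sum_congr rfl fun l _ => ?_
      ring
    rw [e, norm_mul, hnorm, inv_mul_eq_div]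
    gcongr
    exact h.linear i j

end Good

section Probability

variable {n : ℕ} {Ω : Type*} [MeasurableSpace Ω] {μ : Measure Ω} [IsProbabilityMeasure μ] {σ : ℝ}
  {M : Ω → Matrix (Fin n) (Fin n) ℂ} {k : ℕ} {c : ℝ}

/-- With the minor frozen, the resolvent entries are constants and the concentration bound for the
independent row applies, uniformly in the frozen matrix. -/
lemma measureReal_quadratic_le (h : IsWigner μ σ M) (hk : 1 ≤ k) (hc : 0 < c)
    (htail : ∀ i j, HasTail (fun ω => M ω i j) μ k c) (z : ℂ) {t : ℝ} (ht : 0 ≤ t) (i : Fin n) :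
    μ.real {ω | t * Real.sqrt (∑ l, ∑ k, ‖resolventMatrix (normalized (minor (M ω) i)) z l k‖ ^ 2) <
      ‖∑ l, ∑ k, resolventMatrix (normalized (minor (M ω) i)) z l k * offDiagRow (M ω) i l
      * conj (offDiagRow (M ω) i k) - ∑ l, resolventMatrix (normalized (minor (M ω) i)) z l l *
        ((if l = i then 0 else 1 : ℝ) : ℂ)‖} ≤ 2 * deviation k c t := by
  have hX : Measurable fun ω l => offDiagRow (M ω) i l :=
    measurable_pi_lambda _ fun l => measurable_offDiagRow h.measurable_entry i l
  have hR : ∀ l k, Measurable fun p : (Fin n → ℂ) × (Fin n → Fin n → ℂ) =>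
      resolventMatrix (normalized (Matrix.of p.2)) z l k := fun l k =>
    (measurable_resolvent_entry z l k).comp measurable_snd
  exact measureReal_pair_mem_le (indepFun_offDiagRow_minor h i) hX
    (measurable_minor h.measurable_entry i)
    (S := {p | t * Real.sqrt (∑ l, ∑ k, ‖resolventMatrix (normalized (Matrix.of p.2)) z l k‖ ^ 2) <
      ‖∑ l, ∑ k, resolventMatrix (normalized (Matrix.of p.2)) z l k * p.1 l * conj (p.1 k) -
        ∑ l, resolventMatrix (normalized (Matrix.of p.2)) z l l *
        ((if l = i then 0 else 1 : ℝ) : ℂ)‖})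
    (measurableSet_lt (by fun_prop) (by fun_prop))
    (fun A => quadratic_concentration (iIndepFun_offDiagRow h i)
      (measurable_offDiagRow h.measurable_entry i) (integral_offDiagRow h i) hk hc.le
      (HasTail.offDiagRow hc htail i) (integral_norm_sq_offDiagRow h i)
      (fun l => by split_ifs <;> norm_num)
      (fun l k => resolventMatrix (normalized (Matrix.of A)) z l k) ht)

lemma measureReal_linear_le (h : IsWigner μ σ M) (hk : 1 ≤ k) (hc : 0 < c)
    (htail : ∀ i j, HasTail (fun ω => M ω i j) μ k c) (z : ℂ) {t : ℝ} (ht : 0 ≤ t) (i j : Fin n) :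
    μ.real {ω | t * Real.sqrt (∑ l, ‖resolventMatrix (normalized (minor (M ω) i)) z l j‖ ^ 2) <
      ‖∑ l, resolventMatrix (normalized (minor (M ω) i)) z l j * offDiagRow (M ω) i l‖}
      ≤ deviation k c t := by
  have hX : Measurable fun ω l => offDiagRow (M ω) i l :=
    measurable_pi_lambda _ fun l => measurable_offDiagRow h.measurable_entry i l
  have hR : ∀ l k, Measurable fun p : (Fin n → ℂ) × (Fin n → Fin n → ℂ) =>
      resolventMatrix (normalized (Matrix.of p.2)) z l k := fun l k =>
    (measurable_resolvent_entry z l k).comp measurable_snd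
  exact measureReal_pair_mem_le (indepFun_offDiagRow_minor h i) hX
    (measurable_minor h.measurable_entry i)
    (S := {p | t * Real.sqrt (∑ l, ‖resolventMatrix (normalized (Matrix.of p.2)) z l j‖ ^ 2) <
      ‖∑ l, resolventMatrix (normalized (Matrix.of p.2)) z l j * p.1 l‖})
    (measurableSet_lt (by fun_prop) (by fun_prop))
    (fun A => linear_concentration (iIndepFun_offDiagRow h i)
      (measurable_offDiagRow h.measurable_entry i) (integral_offDiagRow h i) hk hc.le
      (HasTail.offDiagRow hc htail i)
      (fun l => resolventMatrix (normalized (Matrix.of A)) z l j) ht)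

lemma HasTail.measureReal_gt_le {f : Ω → ℂ} (hk : 1 ≤ k) (hc : 0 ≤ c) (h : HasTail f μ k c) {s : ℝ}
    (hs : 0 ≤ s) : μ.real {ω | s < ‖f ω‖} ≤ Real.exp (c - s ^ (1 / (k : ℝ))) := by
  rcases le_or_gt c (s ^ (1 / (k : ℝ))) with hcs | hcs
  · have e : (s ^ (1 / (k : ℝ))) ^ k = s := by
      have : (k : ℝ) ≠ 0 := by exact_mod_cast (by omega : k ≠ 0)
      rw [← Real.rpow_natCast, ← Real.rpow_mul hs, one_div, inv_mul_cancel₀ this, Real.rpow_one]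
    have h1 := h _ hcs
    rw [e] at h1
    refine (measureReal_mono fun ω (hω : s < ‖f ω‖) => hω.le).trans (h1.trans ?_)
    apply Real.exp_le_exp.2
    linarith
  · exact measureReal_le_one.trans (Real.one_le_exp (by linarith))

/-- Union bound over `n` diagonal entries, `n` quadratic forms and `n ^ 2` linear forms. -/
lemma measureReal_not_regular_le (h : IsWigner μ σ M) (hk : 1 ≤ k) (hc : 0 < c)
    (htail : ∀ i j, HasTail (fun ω => M ω i j) μ k c) (z : ℂ) {δ t : ℝ} (hδ : 0 ≤ δ) (ht : 0 ≤ t) :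
    μ.real {ω | ¬ Regular (M ω) z δ t} ≤
      n * Real.exp (c - (δ * Real.sqrt n) ^ (1 / (k : ℝ))) + n * (2 * deviation k c t) +
        n * (n * deviation k c t) := by
  set D : Fin n → Set Ω := fun i => {ω | δ * Real.sqrt n < ‖M ω i i‖} with hD
  set Q : Fin n → Set Ω := fun i =>
    {ω | t * Real.sqrt (∑ l, ∑ k, ‖resolventMatrix (normalized (minor (M ω) i)) z l k‖ ^ 2) <
      ‖∑ l, ∑ k, resolventMatrix (normalized (minor (M ω) i)) z l k * offDiagRow (M ω) i l
      * conj (offDiagRow (M ω) i k) - ∑ l, resolventMatrix (normalized (minor (M ω) i)) z l l *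
        ((if l = i then 0 else 1 : ℝ) : ℂ)‖} with hQ
  set N : Fin n → Fin n → Set Ω := fun i j =>
    {ω | t * Real.sqrt (∑ l, ‖resolventMatrix (normalized (minor (M ω) i)) z l j‖ ^ 2) <
      ‖∑ l, resolventMatrix (normalized (minor (M ω) i)) z l j * offDiagRow (M ω) i l‖} with hN
  have hsub : {ω | ¬ Regular (M ω) z δ t} ⊆ ((⋃ i, D i) ∪ ⋃ i, Q i) ∪ ⋃ i, ⋃ j, N i j := by
    intro ω hω
    by_contra hcon
    simp only [Set.mem_union, Set.mem_iUnion, not_or, not_exists] at hcon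
    exact hω ⟨fun i => not_lt.1 (hcon.1.1 i), fun i => not_lt.1 (hcon.1.2 i),
      fun i j => not_lt.1 (hcon.2 i j)⟩
  have hsum : ∀ {a : ℝ} {f : Fin n → Set Ω}, (∀ i, μ.real (f i) ≤ a) →
      μ.real (⋃ i, f i) ≤ n * a := by
    intro a f hf
    refine (measureReal_iUnion_fintype_le f).trans
      ((Finset.sum_le_sum fun i _ => hf i).trans (le_of_eq ?_))
    simp
  refine (measureReal_mono hsub).trans ((measureReal_union_le _ _).trans (add_le_add
    ((measureReal_union_le _ _).trans (add_le_add (hsum fun i => ?_) (hsum fun i => ?_)))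
    (hsum fun i => hsum fun j => ?_)))
  · exact (htail i i).measureReal_gt_le hk hc.le (by positivity)
  · exact measureReal_quadratic_le h hk hc htail z ht i
  · exact measureReal_linear_le h hk hc htail z ht i j

end Probability

end

/-! ### A common decay rate and the descent through dyadic scales. -/

section

/-- For `x ≥ 1`, shrinking both the factor and the exponent to one `γ` only weakens the bounds. The
forms decay in `x = n Im z`, the diagonal in `n`, which plays the role of `y ≥ x` when `Im z ≤ 1`.
-/
lemma exists_decay_exponent {k : ℕ} (hk : 1 ≤ k) {c : ℝ} (hc : 0 < c) {δ : ℝ} (hδ : 0 < δ) :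
    ∃ γ : ℝ, 0 < γ ∧ ∀ x : ℝ, 1 ≤ x →
      deviation k c (δ * Real.sqrt x) ≤ Real.exp (c + 1 - γ * x ^ γ) ∧
      ∀ y, x ≤ y → Real.exp (c - (δ * Real.sqrt y) ^ (1 / (k : ℝ))) ≤
        Real.exp (c + 1 - γ * x ^ γ) := by
  have hG := momentConst_pos hk c
  have hk0 : (0 : ℝ) < k := by exact_mod_cast hk
  set g : ℝ := ((4 * k + 2 : ℕ) : ℝ) with hg
  have hg0 : 0 < g := by rw [hg]; positivity
  have hkg : 2 * (k : ℝ) ≤ g := by rw [hg]; push_cast; linarith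
  set κ₁ := ((δ / 2) ^ 2 / (Real.exp 1 * momentConst k c)) ^ (1 / g) with hκ₁
  set κ₂ := δ ^ (1 / (k : ℝ)) with hκ₂
  have h1 : 0 < κ₁ := by positivity
  have h2 : 0 < κ₂ := by positivity
  set γ := min (min κ₁ κ₂) (1 / g) with hγ
  have hγ0 : 0 < γ := lt_min (lt_min h1 h2) (by positivity)
  have hγ1 : γ ≤ κ₁ := (min_le_left _ _).trans (min_le_left _ _)
  have hγ2 : γ ≤ κ₂ := (min_le_left _ _).trans (min_le_right _ _)
  have hγ3 : γ ≤ 1 / g := min_le_right _ _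
  refine ⟨γ, hγ0, fun x hx => ⟨?_, fun y hxy => ?_⟩⟩
  · have hx0 : 0 ≤ x := by linarith
    have e : ((δ * Real.sqrt x / 2) ^ 2 / (Real.exp 1 * momentConst k c)) ^ (1 / g) =
        κ₁ * x ^ (1 / g) := by
      rw [hκ₁, ← Real.mul_rpow (by positivity) hx0]
      congr 1
      rw [div_pow, mul_pow, Real.sq_sqrt hx0]
      ring
    unfold deviation
    rw [e]
    apply Real.exp_le_exp.2
    have : γ * x ^ γ ≤ κ₁ * x ^ (1 / g) := by gcongr
    linarith
  · have hy1 : 1 ≤ y := hx.trans hxy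
    have hy0 : 0 ≤ y := by linarith
    have e : (δ * Real.sqrt y) ^ (1 / (k : ℝ)) = κ₂ * y ^ (1 / (2 * (k : ℝ))) := by
      rw [Real.mul_rpow hδ.le (Real.sqrt_nonneg _), Real.sqrt_eq_rpow, ← Real.rpow_mul hy0]
      congr 2
      field_simp
    rw [e]
    apply Real.exp_le_exp.2
    have h3 : γ ≤ 1 / (2 * (k : ℝ)) := hγ3.trans (by gcongr)
    have : γ * x ^ γ ≤ κ₂ * y ^ (1 / (2 * (k : ℝ))) := by
      gcongr
      calc x ^ γ ≤ y ^ γ := by gcongr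
        _ ≤ _ := Real.rpow_le_rpow_of_exponent_le hy1 h3
    linarith

/-- The spectral parameter `E + 2 ^ m η √-1`. -/
noncomputable def scale (E η : ℝ) (m : ℕ) : ℂ := (E : ℂ) + ((2 ^ m * η : ℝ) : ℂ) * Complex.I

lemma scale_re (E η : ℝ) (m : ℕ) : (scale E η m).re = E := by
  unfold scale
  rw [Complex.add_re, Complex.ofReal_re, Complex.re_ofReal_mul, Complex.I_re, mul_zero, add_zero]

lemma scale_im (E η : ℝ) (m : ℕ) : (scale E η m).im = 2 ^ m * η := by
  unfold scale
  rw [Complex.add_im, Complex.ofReal_im, Complex.im_ofReal_mul, Complex.I_im]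
  ring

/-- The bootstrap over dyadic scales. -/
lemma norm_resolvent_le_of_regular {n : ℕ} {M : Matrix (Fin n) (Fin n) ℂ} (hM : M.IsHermitian)
    {B K δ E η : ℝ} (hB : 0 ≤ B) (hK : K = 4 * (B + 3)) (hδ : δ = 1 / (24 * K ^ 2))
    (hE : |E| ≤ B) (hη : 0 < η) (hn : 8 * K ≤ n * η)
    (hreg : ∀ m ≤ n, 2 ^ m * η ≤ 1 →
      Regular M (scale E η m) δ (δ * Real.sqrt (n * (2 ^ m * η)))) (i j : Fin n) :
    ‖resolventMatrix (normalized M) (scale E η 0) i j‖ ≤ K := by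
  have hW := normalized_isHermitian hM
  have hK12 : 12 ≤ K := by rw [hK]; linarith
  have him : ∀ m, 0 < (scale E η m).im := fun m => by rw [scale_im]; positivity
  have hlarge : ∀ m, 1 ≤ 2 ^ m * η → ∀ i j,
      ‖resolventMatrix (normalized M) (scale E η m) i j‖ ≤ K := fun m hm i j => by
    refine (norm_resolvent_le hW (him m) i j).trans ?_
    rw [scale_im]
    have : 1 / (2 ^ m * η) ≤ 1 := by rw [div_le_one (by positivity)]; exact hm
    linarith
  -- Induction from the top scale `m = n` down to `m = 0`. The top is large enough because `2 ^ n *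
  -- η ≥ n * η ≥ 8 K ≥ 1`.
  have key : ∀ d m, m + d = n → ∀ i j,
      ‖resolventMatrix (normalized M) (scale E η m) i j‖ ≤ K := by
    intro d
    induction d with
    | zero =>
      intro m hm
      apply hlarge
      have h1 : (n : ℝ) ≤ 2 ^ m := by
        rw [add_zero] at hm
        rw [hm]
        exact_mod_cast Nat.lt_two_pow_self.le
      have h2 : n * η ≤ 2 ^ m * η := by gcongr
      linarith
    | succ d ih =>
      intro m hm
      rcases le_total 1 (2 ^ m * η) with h1 | h1
      · exact hlarge m h1
      · have hap := norm_resolvent_half_le hW (him m) (z' := scale E η (m + 1))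
          (by rw [scale_re, scale_re]) (by rw [scale_im, scale_im]; ring) (ih (m + 1) (by omega))
        have hr := hreg m (by omega) h1
        rw [← scale_im E] at hr
        refine Regular.norm_resolvent_le hM hB hK hδ (by rw [scale_re]; exact hE) (him m)
          (by rw [scale_im]; exact h1) ?_ hap hr
        rw [scale_im]
        have h3 : η ≤ 2 ^ m * η := le_mul_of_one_le_left hη.le (one_le_pow₀ (by norm_num))
        have : n * η ≤ n * (2 ^ m * η) := by gcongr
        linarith
  exact key n 0 (zero_add n) i j

lemma coeffNorm_le {n : ℕ} (hn : 1 ≤ n) {A : Matrix (Fin n) (Fin n) ℂ} {K : ℝ}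
    (h : ∀ i j, ‖A i j‖ ≤ K) : coeffNorm A ≤ K := by
  have : Nonempty (Fin n) := ⟨⟨0, hn⟩⟩
  exact ciSup_le fun p => h p.1 p.2

/-- Rounding `C` up weakens the tail condition only for `t ≥ 1`, hence the maximum with `1`. -/
lemma ExpDecay.hasTail {n : ℕ} {Ω : Type*} [MeasurableSpace Ω] {μ : Measure Ω}
    [IsProbabilityMeasure μ] {C C' : ℝ} {M : Ω → Matrix (Fin n) (Fin n) ℂ} (h : ExpDecay μ C C' M)
    (i j : Fin n) : HasTail (fun ω => M ω i j) μ ⌈C⌉₊ (max C' 1) := by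
  intro t ht
  refine (measureReal_mono fun ω (hω : t ^ ⌈C⌉₊ ≤ ‖M ω i j‖) => ?_).trans (h i j t ((le_max_left _ _).trans ht))
  refine le_trans ?_ hω
  rw [← Real.rpow_natCast]
  exact Real.rpow_le_rpow_of_exponent_le ((le_max_right _ _).trans ht) (Nat.le_ceil C)

end

end WignerResolvent

/-! ### The union bound over scales. -/

open WignerResolvent in
theorem corollaryA6
    (C C' : ℝ) (hC : 0 < C) (hC' : 0 < C')
    (B D : ℝ) :
    ∃ K L a c : ℝ, 0 < K ∧ 0 < L ∧ 0 < a ∧ 0 < c ∧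
      ∀ (n : ℕ), 1 ≤ n →
      ∀ (Ω : Type*) [MeasurableSpace Ω] (μ : Measure Ω) [IsProbabilityMeasure μ]
        (σ : ℝ), 0 < σ →
      ∀ (M : Ω → Matrix (Fin n) (Fin n) ℂ),
        IsWigner μ σ M → ExpDecay μ C C' M →
      ∀ (E η : ℝ), |E| ≤ B → 0 < η → η ≤ D * (n : ℝ) ^ 100 →
        μ.real {ω | ¬ coeffNorm (resolventMatrix (normalized (M ω)) ((E : ℂ) + (η : ℂ) * Complex.I))
            ≤ K}
          ≤ L * (n : ℝ) ^ a * Real.exp (-(c * ((n : ℝ) * η) ^ c)) := by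
  set k := ⌈C⌉₊
  have hk : 1 ≤ k := Nat.ceil_pos.2 hC
  set c₀ := max C' 1
  have hc₀ : 0 < c₀ := lt_max_of_lt_right one_pos
  set K := 4 * (|B| + 3) with hK
  have hK0 : 0 < K := by positivity
  obtain ⟨γ, hγ, hdecay⟩ := exists_decay_exponent hk hc₀ (δ := 1 / (24 * K ^ 2)) (by positivity)
  -- The first term of `L` and the exponent `3` come from at most `2 n` scales, each failing with
  -- probability at most `4 n ^ 2 P`. The second makes the bound trivial for `n η < 8 K`.
  refine ⟨K, 8 * Real.exp (c₀ + 1) + Real.exp (γ * (8 * K) ^ γ), 3, γ, hK0, by positivity,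
    by norm_num, hγ, ?_⟩
  intro n hn Ω _ μ _ σ _ M hM hdec E η hE hη _
  have hn1 : (1 : ℝ) ≤ n := by exact_mod_cast hn
  have hcube : (n : ℝ) ^ (3 : ℝ) = n ^ 3 := by exact_mod_cast Real.rpow_natCast (n : ℝ) 3
  have hE' : |E| ≤ |B| := hE.trans (le_abs_self B)
  rw [hcube]
  set x := (n : ℝ) * η with hx
  have hx0 : 0 < x := by positivity
  rcases lt_or_ge x (8 * K) with hxK | hxK
  · refine measureReal_le_one.trans ?_
    calc (1 : ℝ) = Real.exp (γ * x ^ γ) * Real.exp (-(γ * x ^ γ)) := by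
          rw [← Real.exp_add, add_neg_cancel, Real.exp_zero]
      _ ≤ Real.exp (γ * (8 * K) ^ γ) * Real.exp (-(γ * x ^ γ)) := by gcongr
      _ ≤ (8 * Real.exp (c₀ + 1) + Real.exp (γ * (8 * K) ^ γ)) * n ^ 3 *
          Real.exp (-(γ * x ^ γ)) := by
          gcongr
          have h1 : (1 : ℝ) ≤ n ^ 3 := one_le_pow₀ hn1
          have h2 := Real.exp_pos (c₀ + 1)
          have h3 := Real.exp_pos (γ * (8 * K) ^ γ)
          nlinarith
  have hx1 : 1 ≤ x := by
    have : 12 ≤ K := by rw [hK]; linarith [abs_nonneg B]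
    linarith
  set δ := 1 / (24 * K ^ 2) with hδ
  have hδ0 : 0 < δ := by positivity
  -- Empty at scales with imaginary part above `1`, where no regularity is needed.
  set bad : ℕ → Set Ω := fun m => {ω | 2 ^ m * η ≤ 1 ∧
    ¬ Regular (M ω) (scale E η m) δ (δ * Real.sqrt (n * (2 ^ m * η)))} with hbad
  have hsub : {ω | ¬ coeffNorm (resolventMatrix (normalized (M ω))
      ((E : ℂ) + (η : ℂ) * Complex.I)) ≤ K} ⊆ ⋃ m ∈ Finset.range (n + 1), bad m := by
    intro ω hω
    by_contra hcon
    apply hω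
    simp only [Set.mem_iUnion, not_exists, Finset.mem_range] at hcon
    have := norm_resolvent_le_of_regular (hM.isHermitian ω) (abs_nonneg B) hK hδ hE' hη hxK
      (fun m hm h1 => by
        by_contra h2
        exact hcon m (by omega) ⟨h1, h2⟩)
    simp only [scale, pow_zero, one_mul] at this
    exact coeffNorm_le hn this
  set P := Real.exp (c₀ + 1 - γ * x ^ γ) with hP
  have hP0 : 0 < P := Real.exp_pos _
  have hbadm : ∀ m, μ.real (bad m) ≤ 4 * n ^ 2 * P := by
    intro m
    by_cases hm : 2 ^ m * η ≤ 1
    · have hsub' : bad m ⊆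
          {ω | ¬ Regular (M ω) (scale E η m) δ (δ * Real.sqrt (n * (2 ^ m * η)))} :=
        fun ω hω => hω.2
      have hxy : x ≤ n * (2 ^ m * η) := by
        rw [hx]
        gcongr
        exact le_mul_of_one_le_left hη.le (one_le_pow₀ (by norm_num))
      have hy := hdecay _ (hx1.trans hxy)
      have hmono : Real.exp (c₀ + 1 - γ * (n * (2 ^ m * η)) ^ γ) ≤ P := by
        rw [hP]
        gcongr
      have hny : n * (2 ^ m * η) ≤ n := by nlinarith
      refine (measureReal_mono hsub').trans ((measureReal_not_regular_le hM hk hc₀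
        (fun i j => ExpDecay.hasTail hdec i j) _ hδ0.le (by positivity)).trans ?_)
      calc _ ≤ n * P + n * (2 * P) + n * (n * P) := by
            gcongr
            · exact (hy.2 _ hny).trans hmono
            · exact hy.1.trans hmono
            · exact hy.1.trans hmono
        -- `n + 2 n + n ^ 2 ≤ 4 n ^ 2`.
        _ ≤ _ := by
            have : n * P ≤ n ^ 2 * P := by gcongr; exact le_self_pow₀ hn1 (by norm_num)
            linarith
    · have : bad m = ∅ := by
        rw [Set.eq_empty_iff_forall_notMem]
        exact fun ω hω => hm hω.1
      rw [this, measureReal_empty]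
      positivity
  calc _ ≤ μ.real (⋃ m ∈ Finset.range (n + 1), bad m) := measureReal_mono hsub (measure_ne_top _ _)
    _ ≤ ∑ m ∈ Finset.range (n + 1), μ.real (bad m) := measureReal_biUnion_finset_le _ _
    _ ≤ ∑ _m ∈ Finset.range (n + 1), 4 * n ^ 2 * P := Finset.sum_le_sum fun m _ => hbadm m
    _ = ((n : ℝ) + 1) * (4 * n ^ 2 * P) := by simp
    _ ≤ (2 * n) * (4 * n ^ 2 * P) := by gcongr; linarith
    _ = 8 * Real.exp (c₀ + 1) * n ^ 3 * Real.exp (-(γ * x ^ γ)) := by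
        rw [hP, sub_eq_add_neg, Real.exp_add]; ring
    _ ≤ _ := by
        gcongr
        linarith [Real.exp_pos (γ * (8 * K) ^ γ)]
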